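/- **Theorem 1.4.** For a finite metric space $(X,d)$, let $$\gamma_2(X,d)=\inf\ \sup_{x\in X}\ \sum_{k\ge 0}2^{k/2}\,\mathrm{diam}(A_k(x)),$$ where the infimum is over all sequences $(A_k)_{k\ge 0}$ of partitions of $X$ such that $A_{k+1}$ refines $A_k$, $|A_0|\le 1$ and $|A_k|\le 2^{2^k}$ for $k\ge 1$, and $A_k(x)$ is the block of $A_k$ containing $x$. If for any two points $x,y\in X$ one can deterministically compute $d(x,y)$ in time polynomial in $n=|X|$, then one can deterministically compute, in time polynomial in $n$, a number $A(X,d)$ with $A(X,d)\asymp\gamma_2(X,d)$, where the implied constants are universal. Precisely: there are a constant $C>0$ and a single deterministic program $P$ such that for every polynomial $p$ there is a polynomial $q$ with the following property. Let $(X,d)$ be a finite metric space whose points are numbered $x_0,\dots,x_{n-1}$, and suppose that a procedure is given that returns $d(x,y)$ in time $\tau(x,y)\le p(n)$ for all $x,y\in X$. Then $P$, given $n$ and access to this procedure, halts after time at most $q(n)$ and outputs a real number $A\ge 0$ with $C^{-1}A\le\gamma_2(X,d)\le C\,A$. Here programs are structured programs (sequencing, conditionals, while loops) for a random access machine with natural-number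 and real registers, both with indirect addressing. The machine can set natural-number registers to fixed constants and add, truncatedly subtract and compare natural numbers; it can set real registers to $0$ and add, subtract, halve and compare real numbers. Each elementary step takes one unit of time, and a query of $d(x,y)$ takes $1+\tau(x,y)$ units. -/

import Mathlib

open scoped ENNReal

/-! ### Talagrand's functional -/

/-- The cardinality bounds `M₀ = 1` and `M_k = 2 ^ (2 ^ k)` for `k ≥ 1`. -/
def admissibleBound (k : ℕ) : ℕ := if k = 0 then 1 else 2 ^ 2 ^ k

/-- An admissible sequence of partitions of `X`. A partition is given by its equivalence relation:
`A (k + 1) ≤ A k` says that `A (k + 1)` refines `A k`, and `(A k).classes` is the set of its blocks. -/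
structure IsAdmissible {X : Type*} (A : ℕ → Setoid X) : Prop where
  refines : ∀ k, A (k + 1) ≤ A k
  card_le : ∀ k, (A k).classes.encard ≤ (admissibleBound k : ℕ∞)

/-- `γ₂(X, d) = inf sup_{x ∈ X} ∑_{k ≥ 0} 2 ^ (k / 2) diam (A_k(x))`, the infimum being over all
admissible sequences, and `A_k(x)` being the block of `A_k` that contains `x`. -/
noncomputable def gammaTwo (X : Type*) [MetricSpace X] : ℝ≥0∞ :=
  ⨅ (A : ℕ → Setoid X) (_ : IsAdmissible A),
    ⨆ x : X, ∑' k : ℕ, (2 : ℝ≥0∞) ^ ((k : ℝ) / 2) * Metric.ediam {y : X | A k y x}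

/-! ### Deterministic random access machines with a distance procedure

A machine has natural-number registers and real registers, both with indirect addressing. On
natural numbers it can add, subtract (truncated) and compare; on reals it can add, subtract, halve
and compare. There is no multiplication, no rounding and no constant other than natural numbers,
so unit cost per operation is an honest measure of time: in `t` steps a natural-number register
gets at most `t + O(1)` bits longer, and a real register always holds a linear combination of the
queried distances whose coefficients are dyadic rationals with `O(t)` bits. -/

/-- The contents of the registers. -/
structure Memory where
  nat : ℕ → ℕ
  real : ℕ → ℝ

def Memory.setNat (m : Memory) (a v : ℕ) : Memory := { m with nat := Function.update m.nat a v }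

noncomputable def Memory.setReal (m : Memory) (a : ℕ) (v : ℝ) : Memory :=
  { m with real := Function.update m.real a v }

/-- Elementary instructions; `N` and `R` are the two families of registers. -/
inductive Instr
  /-- `N[a] := v` -/
  | natConst (a v : ℕ)
  /-- `N[a] := N[b] + N[c]` -/
  | natAdd (a b c : ℕ)
  /-- `N[a] := N[b] - N[c]`, or `0` if this is negative -/
  | natSub (a b c : ℕ)
  /-- `N[a] := N[N[b]]` -/
  | natLoad (a b : ℕ)
  /-- `N[N[a]] := N[b]` -/
  | natStore (a b : ℕ)
  /-- `R[a] := 0` -/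
  | realZero (a : ℕ)
  /-- `R[a] := R[b] + R[c]` -/
  | realAdd (a b c : ℕ)
  /-- `R[a] := R[b] - R[c]` -/
  | realSub (a b c : ℕ)
  /-- `R[a] := R[b] / 2` -/
  | realHalf (a b : ℕ)
  /-- `R[a] := R[N[b]]` -/
  | realLoad (a b : ℕ)
  /-- `R[N[a]] := R[b]` -/
  | realStore (a b : ℕ)
  /-- `R[a] :=` the distance between the points number `N[b]` and `N[c]`
  (and `0` if there are no such points) -/
  | query (a b c : ℕ)

/-- The conditions on which a program can branch. -/
inductive Test
  /-- `N[a] < N[b]` -/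
  | natLt (a b : ℕ)
  /-- `R[a] < R[b]` -/
  | realLt (a b : ℕ)

/-- Structured programs. -/
inductive Prog
  | skip
  | instr (i : Instr)
  | seq (P Q : Prog)
  | ite (b : Test) (P Q : Prog)
  | while (b : Test) (P : Prog)

def Test.Holds : Test → Memory → Prop
  | .natLt a b, m => m.nat a < m.nat b
  | .realLt a b, m => m.real a < m.real b

section Semantics

/-- The effect of an instruction, when there are `n` points and `D` gives their distances. -/
noncomputable def Instr.effect {n : ℕ} (D : Fin n → Fin n → ℝ) : Instr → Memory → Memory
  | .natConst a v, m => m.setNat a v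
  | .natAdd a b c, m => m.setNat a (m.nat b + m.nat c)
  | .natSub a b c, m => m.setNat a (m.nat b - m.nat c)
  | .natLoad a b, m => m.setNat a (m.nat (m.nat b))
  | .natStore a b, m => m.setNat (m.nat a) (m.nat b)
  | .realZero a, m => m.setReal a 0
  | .realAdd a b c, m => m.setReal a (m.real b + m.real c)
  | .realSub a b c, m => m.setReal a (m.real b - m.real c)
  | .realHalf a b, m => m.setReal a (m.real b / 2)
  | .realLoad a b, m => m.setReal a (m.real (m.nat b))
  | .realStore a b, m => m.setReal (m.nat a) (m.real b)
  | .query a b c, m => m.setReal a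
      (if h : m.nat b < n ∧ m.nat c < n then D ⟨m.nat b, h.1⟩ ⟨m.nat c, h.2⟩ else 0)

/-- The time that an instruction takes. A query of the distance between the points `i` and `j`
takes, besides one unit, the time `τ i j` that the distance procedure needs for this pair. -/
def Instr.cost {n : ℕ} (τ : Fin n → Fin n → ℕ) : Instr → Memory → ℕ
  | .query _ b c, m =>
      1 + (if h : m.nat b < n ∧ m.nat c < n then τ ⟨m.nat b, h.1⟩ ⟨m.nat c, h.2⟩ else 0)
  | _, _ => 1

/-- A configuration: the programs still to be executed (in this order), the memory, and the time
used so far. -/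
structure Config where
  todo : List Prog
  mem : Memory
  clock : ℕ

open Classical in
/-- One step of the computation; a configuration with nothing left to be executed has halted. -/
noncomputable def Config.step {n : ℕ} (D : Fin n → Fin n → ℝ) (τ : Fin n → Fin n → ℕ) :
    Config → Config
  | ⟨[], m, t⟩ => ⟨[], m, t⟩
  | ⟨.skip :: K, m, t⟩ => ⟨K, m, t + 1⟩
  | ⟨.instr i :: K, m, t⟩ => ⟨K, i.effect D m, t + i.cost τ m⟩
  | ⟨.seq P Q :: K, m, t⟩ => ⟨P :: Q :: K, m, t + 1⟩
  | ⟨.ite b P Q :: K, m, t⟩ => ⟨(if b.Holds m then P else Q) :: K, m, t + 1⟩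
  | ⟨.while b P :: K, m, t⟩ => ⟨if b.Holds m then P :: .while b P :: K else K, m, t + 1⟩

/-- The start of the program `P` for a space with `n` points: `N[0] = n`, and all other registers
are `0`. -/
noncomputable def Config.start (P : Prog) (n : ℕ) : Config :=
  ⟨[P], (⟨fun _ => 0, fun _ => 0⟩ : Memory).setNat 0 n, 0⟩

/-- The program `P`, started for `n` points with distances `D` and query times `τ`, halts after
time `t`, and then its output register `R[0]` holds `A`. As a halted configuration does not change,
`A` and `t` are determined by the other data. -/
def Prog.Outputs {n : ℕ} (P : Prog) (D : Fin n → Fin n → ℝ) (τ : Fin n → Fin n → ℕ)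
    (A : ℝ) (t : ℕ) : Prop :=
  ∃ N : ℕ, ((Config.step D τ)^[N] (Config.start P n)).todo = [] ∧
    ((Config.step D τ)^[N] (Config.start P n)).clock = t ∧
    ((Config.step D τ)^[N] (Config.start P n)).mem.real 0 = A

end Semantics

/-! The algorithm computes, from small scales to large ones, a table of values `F j x` that describe
the most expensive tree of well separated points below the ball of radius `r j` around `x`. The
scales `r 0 ≥ r 1 ≥ …` are distances of the space, starting with the diameter, and `r (j + 1)` is the
largest distance that is at most `r j / 16`; hence there are at most `n ^ 2 + 1` of them, whatever the
aspect ratio of the space. The value `F j x` is the maximum over `i` of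
`F (j + 2) (c i) + r j * √(log i)`, up to constants, where `c 0, c 1, …` are chosen greedily in the
ball: `c i` maximizes `F (j + 2)` among the points of the ball that are not within `r j / 32` of an
earlier choice. As there is no multiplication, `√(log i)` is replaced by `2 ^ level i`, which can be
updated while `i` is counted up. The output is the maximum of `F 0 x + F 1 x`.

All that matters about the values is recorded in `IsEntry`; it has two halves.

* `packing`: the points `c 0, …, c i` are separated, and `F (j + 2)` is smallest at `c i`. Given an
  admissible sequence of partitions, the pigeonhole principle yields one of these points below which
  the blocks of the relevant level still have diameter of order `r j`. Repeating this, one descends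
  to a point whose chaining sum pays for the value (`exists_value_le_chaining`). The room between
  the scales `r j` and `r (j + 2)` keeps the trees below different `c k` apart.
* `cover`: the ball splits into the pieces that were removed by `c 0, c 1, …`, and a piece with a large
  number `i` consists of points at which `F (j + 2)` is smaller than `F j x` by `r j * √(log i)`.
  Splitting in this way at all scales gives every point an address, whose cost `∑ r j * √(log i_j)` is
  at most `F 0 + F 1`, since the sums over even and over odd `j` telescope
  (`gammaTwo_le_ofReal_value`). Reading the addresses at a limited rate, so that at time `b` only
  letters below `2 ^ 4 ^ b` are read, turns them into an admissible sequence of partitions whose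
  chaining sums are bounded by the cost (`gammaTwo_le_of_address`).

The program `gammaTwoProg` is verified with total-correctness triples `Prog.Ends` that carry a bound
for the time; the loops establish `IsScale` and `IsEntry` directly (`gammaTwoProg_ends`). -/

/-! ### Levels -/

/-- The level `a` of an index `i`: the least `a` with `i < 2 ^ 4 ^ a`. Then `2 ^ a` is, up to a
constant factor, `√(log i)`. The recursion is the one that a machine without multiplication
follows. -/
def level : ℕ → ℕ
  | 0 => 0
  | i + 1 => if i + 1 < 2 ^ 4 ^ level i then level i else level i + 1

lemma two_pow_four_pow_lt {a b : ℕ} (h : a < b) : 2 ^ 4 ^ a < 2 ^ 4 ^ b :=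
  Nat.pow_lt_pow_right one_lt_two (Nat.pow_lt_pow_right (by norm_num) h)

lemma lt_of_level (i : ℕ) : i < 2 ^ 4 ^ level i := by
  induction i with
  | zero => positivity
  | succ i ih =>
    rw [level]
    split_ifs with h
    · exact h
    · exact lt_of_le_of_lt ih (two_pow_four_pow_lt (Nat.lt_succ_self _))

lemma le_of_level_eq_succ {i a : ℕ} (h : level i = a + 1) : 2 ^ 4 ^ a ≤ i := by
  induction i with
  | zero => simp [level] at h
  | succ i ih =>
    rw [level] at h
    split_ifs at h with h'
    · exact (ih h).trans (Nat.le_succ i)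
    · obtain rfl : level i = a := by omega
      omega

lemma level_le_iff {i b : ℕ} : level i ≤ b ↔ i < 2 ^ 4 ^ b := by
  constructor
  · intro h
    exact (lt_of_level i).trans_le
      (Nat.pow_le_pow_right (by norm_num) (Nat.pow_le_pow_right (by norm_num) h))
  · intro h
    by_contra! hb
    obtain ⟨a, ha⟩ : ∃ a, level i = a + 1 := ⟨level i - 1, by omega⟩
    have h1 := le_of_level_eq_succ ha
    have h2 : 2 ^ 4 ^ b ≤ 2 ^ 4 ^ a :=
      Nat.pow_le_pow_right (by norm_num) (Nat.pow_le_pow_right (by norm_num) (by omega))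
    omega

/-! ### The tree functional -/

/-- A decreasing sequence of scales for `X`: the first one is the diameter, and each one is
comparable to the largest distance that is at most `1 / 16` of the preceding one. Scales are
distances and not powers of `1 / 16`, as otherwise their number could not be bounded in terms of
the number of points. -/
structure IsScale {X : Type*} [MetricSpace X] (r : ℕ → ℝ) : Prop where
  nonneg : ∀ j, 0 ≤ r j
  dist_le : ∀ x y : X, dist x y ≤ r 0
  attained : r 0 ≤ 0 ∨ ∃ x y : X, r 0 ≤ dist x y
  step : ∀ j, r (j + 1) ≤ r j / 16
  gap : ∀ j, ∀ x y : X, dist x y ≤ r j / 16 → dist x y ≤ r (j + 1)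

/-- `IsEntry r f x v` says that `v` is a valid value of the functional for the ball of radius `r`
around `x`, when `f` holds the values two scales below. By `cover`, the ball splits into numbered
pieces of diameter at most `r / 16`, and `v` exceeds the values of `f` on the `i`-th piece by
`r √(log i)`. By `packing`, up to constants, `v` is not larger than some
`min_k f (c k) + r √(log i)`, where `c 0, …, c i` are points of the ball that are separated on
the scale `r`. -/
structure IsEntry {X : Type*} [MetricSpace X] (r : ℝ) (f : X → ℝ) (x : X) (v : ℝ) : Prop where
  nonneg : 0 ≤ v
  cover : ∃ idx : X → ℕ,
    (∀ z z', dist x z ≤ r → dist x z' ≤ r → idx z = idx z' → dist z z' ≤ r / 16) ∧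
    ∀ z, dist x z ≤ r → f z + r * 2 ^ level (idx z) ≤ v
  packing : v ≤ 0 ∨ ∃ (i : ℕ) (c : ℕ → X),
    (∀ k ≤ i, dist x (c k) ≤ r ∧ v ≤ f (c k) + 2 * r * 2 ^ level i) ∧
    ∀ k ≤ i, ∀ l ≤ i, k ≠ l → r / 32 < dist (c k) (c l)

/-! ### The functional is at most a multiple of `γ₂` -/

section Lower

lemma IsAdmissible.rel_zero {X : Type*} {A : ℕ → Setoid X} (hA : IsAdmissible A) (y z : X) :
    A 0 y z := by
  have h := hA.card_le 0
  rw [admissibleBound, if_pos rfl, Nat.cast_one, Set.encard_le_one_iff] at h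
  exact (Set.ext_iff.1 (h _ _ ((A 0).mem_classes y) ((A 0).mem_classes z)) y).1 ((A 0).refl y)

/-- More points than blocks: two of them lie in one block. -/
lemma IsAdmissible.exists_same_block {X : Type*} [Finite X] {A : ℕ → Setoid X}
    (hA : IsAdmissible A) {b i : ℕ} (hi : 2 ^ 4 ^ b ≤ i) (z : ℕ → X) :
    ∃ k ≤ i, ∃ l ≤ i, k ≠ l ∧ A (2 * b) (z k) (z l) := by
  classical
  have hfin : (A (2 * b)).classes.Finite := Set.toFinite _
  have hcard : hfin.toFinset.card ≤ 2 ^ 4 ^ b := by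
    have h := hA.card_le (2 * b)
    rw [hfin.encard_eq_coe_toFinset_card] at h
    have h' : hfin.toFinset.card ≤ admissibleBound (2 * b) := by exact_mod_cast h
    refine h'.trans ?_
    unfold admissibleBound
    split_ifs
    · exact Nat.one_le_two_pow
    · rw [pow_mul]; norm_num
  obtain ⟨k, hk, l, hl, hkl, h⟩ := Finset.exists_ne_map_eq_of_card_lt_of_maps_to
    (s := Finset.range (i + 1)) (t := hfin.toFinset) (f := fun k => {y | A (2 * b) y (z k)})
    (by rw [Finset.card_range]; omega)
    (by
      intro k _
      simp only [Set.Finite.coe_toFinset]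
      exact (A (2 * b)).mem_classes (z k))
  refine ⟨k, by simpa [Nat.lt_succ_iff] using hk, l, by simpa [Nat.lt_succ_iff] using hl, hkl, ?_⟩
  have : z k ∈ {y | A (2 * b) y (z k)} := (A (2 * b)).refl (z k)
  rw [h] at this
  exact this

variable {X : Type*} [MetricSpace X] [Fintype X]

lemma dist_le_diam_block {s : Setoid X} {y y' z : X} (h : s y z) (h' : s y' z) :
    dist y y' ≤ Metric.diam {y | s y z} :=
  Metric.dist_le_diam_of_mem (Set.toFinite _).isBounded h h'

variable {r : ℕ → ℝ} {F : ℕ → X → ℝ} {M : ℕ}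

/-- Descending from scale to scale, always to a separated point below which the block of the
relevant level has large diameter, one arrives at a point `z` whose chaining sum dominates the
value. The truncation of the diameters at the current scale makes the induction work: the new
summand pays for the difference of the truncations. -/
lemma exists_value_le_chaining (hr : IsScale (X := X) r)
    (hF : ∀ j x, IsEntry (r j) (F (j + 2)) x (F j x)) (hM : ∀ j, M ≤ j → ∀ x, F j x ≤ 0)
    {A : ℕ → Setoid X} (hA : IsAdmissible A) (j : ℕ) (x : X) :
    ∃ z, dist x z ≤ 2 * r j ∧ F j x ≤ 4 * r j + 512 *
      ∑ b ∈ Finset.range (Fintype.card X), 2 ^ b *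
        min (r j / 64) (Metric.diam {y | A (2 * b) y z}) := by
  have hsum0 : ∀ j z, 0 ≤ ∑ b ∈ Finset.range (Fintype.card X), (2 : ℝ) ^ b *
      min (r j / 64) (Metric.diam {y | A (2 * b) y z}) := fun j z =>
    Finset.sum_nonneg fun b _ => mul_nonneg (by positivity)
      (le_min (by have := hr.nonneg j; positivity) Metric.diam_nonneg)
  obtain ⟨N, hN⟩ : ∃ N, M ≤ j + 2 * N := ⟨M, by omega⟩
  induction N generalizing j x with
  | zero =>
    refine ⟨x, by simpa using hr.nonneg j, ?_⟩
    linarith [hM j (by omega) x, hsum0 j x, hr.nonneg j]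
  | succ N ih =>
    have hj := hr.nonneg j
    have hj2 := hr.nonneg (j + 2)
    have hs : r (j + 2) ≤ r j / 256 := by linarith [hr.step j, hr.step (j + 1)]
    rcases (hF j x).packing with h0 | ⟨i, c, hc, hsep⟩
    · refine ⟨x, by simpa using hr.nonneg j, ?_⟩
      linarith [hsum0 j x]
    choose z hz hzF using fun k => ih (j + 2) (c k) (by omega)
    have hmono : ∀ b k, (2 : ℝ) ^ b * min (r (j + 2) / 64) (Metric.diam {y | A (2 * b) y (z k)})
        ≤ 2 ^ b * min (r j / 64) (Metric.diam {y | A (2 * b) y (z k)}) := fun b k => by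
      gcongr; linarith
    have hdist : ∀ k ≤ i, dist x (z k) ≤ 2 * r j := fun k hk => by
      linarith [dist_triangle x (c k) (z k), hz k, (hc k hk).1]
    rcases hl : level i with _ | b
    · refine ⟨z 0, hdist 0 (Nat.zero_le i), ?_⟩
      have h1 := (hc 0 (Nat.zero_le i)).2
      rw [hl] at h1
      have h2 := hzF 0
      have h3 := Finset.sum_le_sum (s := Finset.range (Fintype.card X)) fun b _ => hmono b 0
      linarith
    -- a separated point with a large block of level `2 * b` below it
    obtain ⟨k, hk, hkd⟩ : ∃ k ≤ i, r j / 64 ≤ Metric.diam {y | A (2 * b) y (z k)} := by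
      by_contra! hcon
      obtain ⟨k, hk, l, hl', hkl, hA'⟩ := hA.exists_same_block (le_of_level_eq_succ hl) z
      have h1 := dist_le_diam_block hA' ((A (2 * b)).refl (z l))
      have h2 := hcon l hl'
      have h3 := hsep k hk l hl' hkl
      have h4 := dist_triangle4 (c k) (z k) (z l) (c l)
      have h5 := hz k
      have h6 := hz l
      rw [dist_comm] at h6
      linarith
    refine ⟨z k, hdist k hk, ?_⟩
    have hb : b ∈ Finset.range (Fintype.card X) := by
      rw [Finset.mem_range]
      have hinj : Function.Injective fun k : Fin (i + 1) => c k := by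
        intro k l hkl
        by_contra hne
        have := hsep k (by omega) l (by omega) (fun h => hne (Fin.ext h))
        simp only at hkl
        rw [hkl, dist_self] at this
        linarith
      have h1 := Fintype.card_le_of_injective _ hinj
      rw [Fintype.card_fin] at h1
      have h2 := le_of_level_eq_succ hl
      have h3 : b < 4 ^ b := Nat.lt_pow_self (by norm_num)
      have h4 : 4 ^ b < 2 ^ 4 ^ b := Nat.lt_pow_self (by norm_num)
      omega
    have h1 := (hc k hk).2
    rw [hl] at h1
    have h2 := hzF k
    rw [← Finset.add_sum_erase _ _ hb] at h2 ⊢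
    have h3 := Finset.sum_le_sum (s := (Finset.range (Fintype.card X)).erase b)
      fun b _ => hmono b k
    rw [min_eq_left hkd]
    have h4 : (2 : ℝ) ^ b * min (r (j + 2) / 64) (Metric.diam {y | A (2 * b) y (z k)})
        ≤ 2 ^ b * (r j / 64 - r j / 128) := by
      gcongr
      exact (min_le_left _ _).trans (by linarith)
    have h5 : (2 : ℝ) ^ (b + 1) = 2 * 2 ^ b := pow_succ' 2 b
    rw [h5] at h1
    have h6 : (0 : ℝ) ≤ 2 ^ b * r j := by positivity
    nlinarith

theorem ofReal_value_le_gammaTwo (hr : IsScale (X := X) r)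
    (hF : ∀ j x, IsEntry (r j) (F (j + 2)) x (F j x)) (hM : ∀ j, M ≤ j → ∀ x, F j x ≤ 0)
    (j : ℕ) (x : X) : ENNReal.ofReal (F j x) ≤ ENNReal.ofReal 516 * gammaTwo X := by
  unfold gammaTwo
  rw [ENNReal.mul_iInf_of_ne (by simp) (by simp)]
  refine le_iInf fun A => ?_
  rw [ENNReal.mul_iInf_of_ne (by simp) (by simp)]
  refine le_iInf fun hA => ?_
  obtain ⟨z, -, hz⟩ := exists_value_le_chaining hr hF hM hA j x
  have hanti : ∀ j, r j ≤ r 0 := fun j => by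
    induction j with
    | zero => exact le_rfl
    | succ j ih => linarith [hr.step j, hr.nonneg j]
  have hcard : 0 < Fintype.card X := Fintype.card_pos_iff.2 ⟨x⟩
  have hdiam : r 0 ≤ Metric.diam {y | A (2 * 0) y z} := by
    rcases hr.attained with h | ⟨y, y', h⟩
    · exact h.trans Metric.diam_nonneg
    exact h.trans (dist_le_diam_block (hA.rel_zero y z) (hA.rel_zero y' z))
  have hsum : F j x ≤ 516 * ∑ b ∈ Finset.range (Fintype.card X),
      2 ^ b * Metric.diam {y | A (2 * b) y z} := by
    have h1 : ∑ b ∈ Finset.range (Fintype.card X),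
        2 ^ b * min (r j / 64) (Metric.diam {y | A (2 * b) y z}) ≤
        ∑ b ∈ Finset.range (Fintype.card X), 2 ^ b * Metric.diam {y | A (2 * b) y z} := by
      gcongr with b
      exact min_le_right _ _
    have h2 : (2 : ℝ) ^ 0 * Metric.diam {y | A (2 * 0) y z} ≤
        ∑ b ∈ Finset.range (Fintype.card X), 2 ^ b * Metric.diam {y | A (2 * b) y z} :=
      Finset.single_le_sum (f := fun b => (2 : ℝ) ^ b * Metric.diam {y | A (2 * b) y z})
        (fun b _ => mul_nonneg (by positivity) Metric.diam_nonneg) (Finset.mem_range.2 hcard)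
    rw [pow_zero, one_mul] at h2
    linarith [hanti j]
  calc ENNReal.ofReal (F j x)
      ≤ ENNReal.ofReal (516 * ∑ b ∈ Finset.range (Fintype.card X),
          2 ^ b * Metric.diam {y | A (2 * b) y z}) := ENNReal.ofReal_le_ofReal hsum
    _ = ENNReal.ofReal 516 * ∑ b ∈ Finset.range (Fintype.card X),
          (2 : ℝ≥0∞) ^ (((2 * b : ℕ) : ℝ) / 2) * Metric.ediam {y | A (2 * b) y z} := by
        rw [ENNReal.ofReal_mul (by norm_num), ENNReal.ofReal_sum_of_nonneg
          fun b _ => mul_nonneg (by positivity) Metric.diam_nonneg]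
        congr 1
        refine Finset.sum_congr rfl fun b _ => ?_
        rw [ENNReal.ofReal_mul (by positivity), ENNReal.ofReal_pow (by norm_num), Metric.diam,
          ENNReal.ofReal_toReal (Set.toFinite _).isBounded.ediam_ne_top,
          show ((2 * b : ℕ) : ℝ) / 2 = (b : ℕ) by push_cast; ring, ENNReal.rpow_natCast]
        norm_num
    _ ≤ ENNReal.ofReal 516 * ∑' k : ℕ,
          (2 : ℝ≥0∞) ^ ((k : ℝ) / 2) * Metric.ediam {y | A k y z} := by
        gcongr
        rw [← Finset.sum_image (s := Finset.range (Fintype.card X)) (g := fun b => 2 * b)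
          (f := fun k : ℕ => (2 : ℝ≥0∞) ^ ((k : ℝ) / 2) * Metric.ediam {y | A k y z})
          (fun a _ b _ h => by simpa using h)]
        exact ENNReal.sum_le_tsum _
    _ ≤ _ := by
        gcongr
        exact le_iSup (fun x => ∑' k : ℕ,
          (2 : ℝ≥0∞) ^ ((k : ℝ) / 2) * Metric.ediam {y | A k y x}) z

end Lower

/-! ### `γ₂` is at most a multiple of the functional -/

section Chaining

variable {X : Type*} (idx : ℕ → X → ℕ)

/-- Every point `z` has the address `idx 0 z, idx 1 z, …` in a tree. At time `b`, the part of the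
address that has been read has length `readLength idx b z`: the next letter is read at time `b` if
there are at most `2 ^ 4 ^ b` letters that are not larger, and otherwise only the fact that it is
large is noted. -/
def readLength : ℕ → X → ℕ
  | 0, _ => 0
  | b + 1, z =>
    if level (idx (readLength b z) z) ≤ b then readLength b z + 1 else readLength b z

/-- What is learnt about `z` at time `b`: the next letter of its address, or that this letter is
at least `2 ^ 4 ^ b`. -/
def readLabel (b : ℕ) (z : X) : ℕ := min (idx (readLength idx b z) z) (2 ^ 4 ^ b)

/-- The partition according to what is known at time `b`. -/
def readSetoid (b : ℕ) : Setoid X where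
  r z z' := ∀ a < b, readLabel idx a z = readLabel idx a z'
  iseqv :=
    ⟨fun _ _ _ => rfl, fun h a ha => (h a ha).symm, fun h h' a ha => (h a ha).trans (h' a ha)⟩

lemma readSetoid_iff {b : ℕ} {z z' : X} :
    readSetoid idx b z z' ↔ ∀ a < b, readLabel idx a z = readLabel idx a z' := Iff.rfl

lemma readLabel_lt_iff {b : ℕ} {z : X} :
    readLabel idx b z < 2 ^ 4 ^ b ↔ level (idx (readLength idx b z) z) ≤ b := by
  rw [readLabel, level_le_iff, min_lt_iff]
  simp

lemma readSetoid_spec {b : ℕ} {z z' : X} (h : readSetoid idx b z z') :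
    readLength idx b z = readLength idx b z' ∧
      ∀ j < readLength idx b z, idx j z = idx j z' := by
  induction b with
  | zero => simp [readLength]
  | succ b ih =>
    rw [readSetoid_iff] at h
    obtain ⟨h1, h2⟩ := ih ((readSetoid_iff idx).2 fun a ha => h a (by omega))
    have hb := h b (Nat.lt_succ_self b)
    have hiff := readLabel_lt_iff idx (b := b) (z := z)
    have hiff' := readLabel_lt_iff idx (b := b) (z := z')
    by_cases hlt : readLabel idx b z < 2 ^ 4 ^ b
    · have hlt' := hlt
      rw [hb] at hlt'
      rw [readLength, readLength, if_pos (hiff.1 hlt), if_pos (hiff'.1 hlt')]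
      refine ⟨by rw [h1], fun j hj => ?_⟩
      rcases Nat.lt_succ_iff_lt_or_eq.1 hj with hj | rfl
      · exact h2 j hj
      · rw [readLabel, min_lt_iff] at hlt hlt'
        rw [readLabel, readLabel, min_eq_left (by omega), min_eq_left (by omega)] at hb
        rw [hb, h1]
    · have hlt' := hlt
      rw [hb] at hlt'
      rw [readLength, readLength, if_neg (mt hiff.2 hlt), if_neg (mt hiff'.2 hlt')]
      exact ⟨h1, h2⟩

lemma encard_classes_readSetoid_le (b : ℕ) :
    (readSetoid idx b).classes.encard ≤ if b = 0 then 1 else (2 ^ 4 ^ b : ℕ) := by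
  -- a block is determined by the labels, of which the `a`-th takes `2 ^ 4 ^ a + 1` values
  have h1 : (readSetoid idx b).classes.encard ≤
      (Set.univ : Set ((a : Fin b) → Fin (2 ^ 4 ^ (a : ℕ) + 1))).encard := by
    let lab : X → (a : Fin b) → Fin (2 ^ 4 ^ (a : ℕ) + 1) := fun z a =>
      ⟨readLabel idx a z, Nat.lt_succ_of_le (min_le_right _ _)⟩
    have h : (readSetoid idx b).classes ⊆ (fun l => {z | lab z = l}) '' Set.univ := by
      rintro _ ⟨y, rfl⟩
      refine ⟨lab y, trivial, ?_⟩
      ext z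
      simp only [Set.mem_ofPred_eq, readSetoid_iff, lab, funext_iff, Fin.ext_iff]
      exact ⟨fun h a ha => h ⟨a, ha⟩, fun h a => h a a.2⟩
    exact (Set.encard_le_encard h).trans (Set.encard_image_le _ _)
  refine h1.trans ?_
  rw [Set.encard_univ, ENat.card_eq_coe_fintype_card, Fintype.card_pi]
  simp only [Fintype.card_fin]
  rw [Fin.prod_univ_eq_prod_range (fun a => 2 ^ 4 ^ a + 1) b]
  split_ifs with hb
  · subst hb; simp
  norm_cast
  clear h1 hb
  induction b with
  | zero => simp
  | succ b ih =>
    rw [Finset.prod_range_succ]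
    calc _ ≤ 2 ^ 4 ^ b * 2 ^ (3 * 4 ^ b) := by
          gcongr
          calc 2 ^ 4 ^ b + 1 ≤ 2 ^ 4 ^ b * 2 := by have := Nat.one_le_two_pow (n := 4 ^ b); omega
            _ = 2 ^ (4 ^ b + 1) := by rw [pow_succ]
            _ ≤ _ := Nat.pow_le_pow_right (by norm_num)
              (by have := Nat.one_le_pow b 4 (by norm_num); omega)
      _ = _ := by rw [← pow_add]; congr 1; ring

lemma isAdmissible_readSetoid : IsAdmissible fun k => readSetoid idx (k / 2) where
  refines k := fun z z' h => (readSetoid_iff idx).2 fun a ha => h a (by omega)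
  card_le k := by
    refine (encard_classes_readSetoid_le idx _).trans ?_
    unfold admissibleBound
    split_ifs with h h' h'
    · simp
    · norm_cast; exact Nat.one_le_two_pow
    · omega
    · norm_cast
      refine Nat.pow_le_pow_right (by norm_num) ?_
      rw [show 4 = 2 ^ 2 by norm_num, ← pow_mul]
      exact Nat.pow_le_pow_right (by norm_num) (by omega)

/-- The times `b` before a large letter is read form a geometric sum that is dominated by its last
term, which this letter pays for; after an early reading, the scale drops by a factor that outweighs
the growth of `2 ^ b`. -/
lemma sum_readLength_le {r φ : ℕ → ℝ} (hr : ∀ j, 0 ≤ r j) (hstep : ∀ j, r (j + 1) ≤ r j / 16)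
    (hφ : ∀ j, 0 ≤ φ j) (z : X) (hpay : ∀ j, φ (j + 1) + r j * 2 ^ level (idx j z) ≤ φ j)
    (N : ℕ) : ∑ b ∈ Finset.range N, 2 ^ b * r (readLength idx b z) ≤ 5 * φ 0 := by
  have key : ∀ K b, ∑ a ∈ Finset.range K, 2 ^ (b + a) * r (readLength idx (b + a) z)
      + 3 * (2 ^ b * r (readLength idx b z)) ≤
      5 * max (2 ^ b * r (readLength idx b z))
        (r (readLength idx b z) * 2 ^ level (idx (readLength idx b z) z))
      + 5 * φ (readLength idx b z + 1) := by
    intro K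
    induction K with
    | zero =>
      intro b
      have h1 : 0 ≤ 2 ^ b * r (readLength idx b z) := mul_nonneg (by positivity) (hr _)
      have h2 := le_max_left (2 ^ b * r (readLength idx b z))
        (r (readLength idx b z) * 2 ^ level (idx (readLength idx b z) z))
      simp only [Finset.range_zero, Finset.sum_empty]
      linarith [hφ (readLength idx b z + 1)]
    | succ K ih =>
      intro b
      have h := ih (b + 1)
      rw [Finset.sum_range_succ']
      have hshift : ∑ a ∈ Finset.range K, 2 ^ (b + (a + 1)) * r (readLength idx (b + (a + 1)) z) =
          ∑ a ∈ Finset.range K, 2 ^ (b + 1 + a) * r (readLength idx (b + 1 + a) z) :=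
        Finset.sum_congr rfl fun a _ => by rw [show b + (a + 1) = b + 1 + a by ring]
      rw [hshift, add_zero]
      rw [readLength] at h
      set d := readLength idx b z with hd
      have h1 : 0 ≤ 2 ^ b * r d := mul_nonneg (by positivity) (hr _)
      by_cases hl : level (idx d z) ≤ b
      · rw [if_pos hl] at h
        have h2 : 2 ^ (b + 1) * r (d + 1) ≤ 2 ^ b * r d / 8 := by
          rw [pow_succ]
          have := mul_le_mul_of_nonneg_left (hstep d) (show (0 : ℝ) ≤ 2 ^ b * 2 by positivity)
          linarith
        have h3 : 0 ≤ 2 ^ (b + 1) * r (d + 1) := mul_nonneg (by positivity) (hr _)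
        have h4 : 0 ≤ r (d + 1) * 2 ^ level (idx (d + 1) z) := mul_nonneg (hr _) (by positivity)
        have h5 := max_le_add_of_nonneg h3 h4
        have h6 := le_max_left (2 ^ b * r d) (r d * 2 ^ level (idx d z))
        linarith [hpay (d + 1)]
      · rw [if_neg hl] at h
        have h2 : 2 ^ (b + 1) * r d ≤ r d * 2 ^ level (idx d z) := by
          rw [mul_comm]
          exact mul_le_mul_of_nonneg_left
            (pow_le_pow_right₀ (by norm_num) (by omega)) (hr _)
        have h3 : 2 ^ (b + 1) * r d = 2 * (2 ^ b * r d) := by rw [pow_succ]; ring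
        rw [max_eq_right h2] at h
        rw [max_eq_right (by linarith)]
        linarith
  have h := key N 0
  simp only [zero_add, pow_zero, one_mul] at h
  rw [show readLength idx 0 z = 0 from rfl, max_eq_right] at h
  · linarith [hpay 0, hr 0]
  · exact le_mul_of_one_le_right (hr 0) (one_le_pow₀ (by norm_num))

lemma two_rpow_half_le (b : ℕ) : (2 : ℝ≥0∞) ^ (((2 * b : ℕ) : ℝ) / 2) = 2 ^ b ∧
    (2 : ℝ≥0∞) ^ (((2 * b + 1 : ℕ) : ℝ) / 2) ≤ 2 * 2 ^ b := by
  constructor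
  · rw [show ((2 * b : ℕ) : ℝ) / 2 = (b : ℕ) by push_cast; ring, ENNReal.rpow_natCast]
  · rw [← pow_succ', ← ENNReal.rpow_natCast]
    refine ENNReal.rpow_le_rpow_of_exponent_le (by norm_num) ?_
    push_cast; linarith

/-- Chaining along addresses: `γ₂` is at most a multiple of the cost of the most expensive
address. -/
theorem gammaTwo_le_of_address [MetricSpace X] {r : ℕ → ℝ} {φ : X → ℕ → ℝ} (hr : ∀ j, 0 ≤ r j)
    (hstep : ∀ j, r (j + 1) ≤ r j / 16) (hφ : ∀ z j, 0 ≤ φ z j)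
    (hdist : ∀ j z z', (∀ i < j, idx i z = idx i z') → dist z z' ≤ r j)
    (hpay : ∀ z j, φ z (j + 1) + r j * 2 ^ level (idx j z) ≤ φ z j) {V : ℝ}
    (hV : ∀ z, φ z 0 ≤ V) : gammaTwo X ≤ ENNReal.ofReal (15 * V) := by
  refine (iInf₂_le _ (isAdmissible_readSetoid idx)).trans (iSup_le fun z => ?_)
  have hdiam : ∀ b, Metric.ediam {y | readSetoid idx b y z} ≤
      ENNReal.ofReal (r (readLength idx b z)) := fun b => by
    refine Metric.ediam_le fun y hy y' hy' => ?_
    rw [edist_dist]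
    refine ENNReal.ofReal_le_ofReal (hdist _ _ _ fun i hi => ?_)
    have h1 := readSetoid_spec idx hy
    have h2 := readSetoid_spec idx hy'
    rw [h1.2 i (by omega), h2.2 i (by omega)]
  refine ENNReal.tsum_le_of_sum_range_le fun N => ?_
  have h2N : ∀ N, ∑ k ∈ Finset.range (2 * N),
      (2 : ℝ≥0∞) ^ ((k : ℝ) / 2) * Metric.ediam {y | readSetoid idx (k / 2) y z} ≤
      3 * ∑ b ∈ Finset.range N, 2 ^ b * ENNReal.ofReal (r (readLength idx b z)) := by
    intro N
    induction N with
    | zero => simp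
    | succ N ih =>
      rw [show 2 * (N + 1) = 2 * N + 1 + 1 by ring, Finset.sum_range_succ, Finset.sum_range_succ,
        Finset.sum_range_succ _ N, mul_add, add_assoc]
      refine add_le_add ih ?_
      rw [show (2 * N) / 2 = N by omega, show (2 * N + 1) / 2 = N by omega, ← add_mul, ← mul_assoc]
      refine mul_le_mul' ?_ (hdiam N)
      rw [(two_rpow_half_le N).1]
      refine (add_le_add le_rfl (two_rpow_half_le N).2).trans (le_of_eq ?_)
      ring
  calc _ ≤ ∑ k ∈ Finset.range (2 * N),
      (2 : ℝ≥0∞) ^ ((k : ℝ) / 2) * Metric.ediam {y | readSetoid idx (k / 2) y z} :=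
        Finset.sum_le_sum_of_subset (Finset.range_subset_range.2 (by omega))
    _ ≤ _ := h2N N
    _ = ENNReal.ofReal (3 * ∑ b ∈ Finset.range N, 2 ^ b * r (readLength idx b z)) := by
        rw [ENNReal.ofReal_mul (by norm_num), ENNReal.ofReal_sum_of_nonneg
          fun b _ => mul_nonneg (by positivity) (hr _)]
        congr 1
        · norm_num
        · refine Finset.sum_congr rfl fun b _ => ?_
          rw [ENNReal.ofReal_mul (by positivity), ENNReal.ofReal_pow (by norm_num)]
          norm_num
    _ ≤ _ := ENNReal.ofReal_le_ofReal (by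
        linarith [sum_readLength_le idx hr hstep (hφ z) z (hpay z) N, hV z])

end Chaining

section Upper

variable {X : Type*} (I : ℕ → X → X → ℕ)

/-- A point of the block of `z` that depends on the block only. -/
noncomputable def Setoid.center (s : Setoid X) (z : X) : X := (Quotient.mk s z).out

lemma Setoid.center_rel (s : Setoid X) (z : X) : s (s.center z) z :=
  Quotient.exact (s := s) (Quotient.out_eq _)

lemma Setoid.center_eq {s : Setoid X} {z z' : X} (h : s z z') : s.center z = s.center z' := by
  rw [Setoid.center, Setoid.center, Quotient.sound (s := s) h]

/-- Nested partitions: every block of the `j`-th one is split according to the numbers that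
`I j x` assigns to its points, where `x` is the chosen point of the block. -/
noncomputable def splitSetoid : ℕ → Setoid X
  | 0 => ⊤
  | j + 1 => splitSetoid j ⊓ Setoid.ker fun z => I j ((splitSetoid j).center z) z

/-- The number of `z` within its block of the `j`-th partition. -/
noncomputable def splitIdx (j : ℕ) (z : X) : ℕ := I j ((splitSetoid I j).center z) z

lemma splitSetoid_succ_iff {j : ℕ} {z z' : X} : splitSetoid I (j + 1) z z' ↔
    splitSetoid I j z z' ∧ splitIdx I j z = splitIdx I j z' := Iff.rfl

lemma splitSetoid_iff {j : ℕ} {z z' : X} :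
    splitSetoid I j z z' ↔ ∀ i < j, splitIdx I i z = splitIdx I i z' := by
  induction j with
  | zero => exact ⟨fun _ i hi => absurd hi (Nat.not_lt_zero i), fun _ => trivial⟩
  | succ j ih => rw [splitSetoid_succ_iff, ih, Nat.forall_lt_succ_right]

theorem gammaTwo_le_ofReal_value [MetricSpace X] {r : ℕ → ℝ} {F : ℕ → X → ℝ}
    (hr : IsScale (X := X) r) (hF : ∀ j x, IsEntry (r j) (F (j + 2)) x (F j x)) {V : ℝ}
    (h0 : ∀ x, F 0 x ≤ V) (h1 : ∀ x, F 1 x ≤ V) : gammaTwo X ≤ ENNReal.ofReal (15 * (2 * V)) := by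
  choose I hI hIF using fun j x => (hF j x).cover
  have hdist : ∀ j z z', splitSetoid I j z z' → dist z z' ≤ r j := by
    intro j
    induction j with
    | zero => exact fun z z' _ => hr.dist_le z z'
    | succ j ih =>
      intro z z' h
      rw [splitSetoid_succ_iff] at h
      have hc := Setoid.center_eq h.1
      refine hr.gap j _ _ (hI j ((splitSetoid I j).center z) z z'
        (ih _ _ (Setoid.center_rel _ _)) (hc ▸ ih _ _ (Setoid.center_rel _ _)) ?_)
      have h2 := h.2
      rwa [splitIdx, splitIdx, ← hc] at h2
  have hpay : ∀ z j, F (j + 2) ((splitSetoid I (j + 2)).center z) +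
      r j * 2 ^ level (splitIdx I j z) ≤ F j ((splitSetoid I j).center z) := by
    intro z j
    -- the next but one center still lies in the piece that contains `z`
    have h := (splitSetoid_iff I).1 (Setoid.center_rel (splitSetoid I (j + 2)) z)
    set y := (splitSetoid I (j + 2)).center z
    have hyz : splitSetoid I j y z := (splitSetoid_iff I).2 fun i hi => h i (by omega)
    have hj := h j (by omega)
    have hc := Setoid.center_eq hyz
    have h2 := hIF j _ y (hdist j _ _ (Setoid.center_rel (splitSetoid I j) y))
    rw [← hj, ← hc]
    exact h2
  refine gammaTwo_le_of_address (splitIdx I) (r := r)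
    (φ := fun z j => F j ((splitSetoid I j).center z) + F (j + 1) ((splitSetoid I (j + 1)).center z))
    hr.nonneg hr.step (fun z j => add_nonneg (hF _ _).nonneg (hF _ _).nonneg)
    (fun j z z' h => hdist j z z' ((splitSetoid_iff I).2 h)) (fun z j => ?_) (fun z => ?_)
  · have := hpay z j
    simp only [add_assoc, Nat.reduceAdd] at this ⊢
    linarith
  · have := h0 ((splitSetoid I 0).center z)
    have := h1 ((splitSetoid I (0 + 1)).center z)
    simp only [zero_add] at *
    linarith

end Upper

/-! ### Total correctness with time bounds -/

@[simp] lemma Memory.setNat_nat (m : Memory) (a v b : ℕ) :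
    (m.setNat a v).nat b = if b = a then v else m.nat b := Function.update_apply ..

@[simp] lemma Memory.setNat_real (m : Memory) (a v : ℕ) : (m.setNat a v).real = m.real := rfl

@[simp] lemma Memory.setReal_nat (m : Memory) (a : ℕ) (v : ℝ) : (m.setReal a v).nat = m.nat := rfl

@[simp] lemma Memory.setReal_real (m : Memory) (a : ℕ) (v : ℝ) (b : ℕ) :
    (m.setReal a v).real b = if b = a then v else m.real b := Function.update_apply ..

/-- The distance that is returned to a query. -/
noncomputable def pairDist {n : ℕ} (D : Fin n → Fin n → ℝ) (i j : ℕ) : ℝ :=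
  if h : i < n ∧ j < n then D ⟨i, h.1⟩ ⟨j, h.2⟩ else 0

/-- The program that carries out a list of instructions. -/
def Prog.block : List Instr → Prog
  | [] => .skip
  | i :: l => .seq (.instr i) (.block l)

/-- The loop "for `N[i] = 0, …, N[0] - 1` do `P`"; the register `N[1]` has to hold `1`. -/
def Prog.forBelow (i : ℕ) (P : Prog) : Prog :=
  .seq (.block [.natConst i 0])
    (.while (.natLt i 0) (.seq P (.block [.natAdd i i 1])))

/-- All natural-number registers into which the instruction can write are in the list `S`.
Indirect writes are not admitted. -/
def Instr.natWithin (S : List ℕ) : Instr → Bool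
  | .natConst a _ => S.contains a
  | .natAdd a _ _ => S.contains a
  | .natSub a _ _ => S.contains a
  | .natLoad a _ => S.contains a
  | .natStore _ _ => false
  | _ => true

/-- All real registers into which the instruction can write are in the list `S`.
Indirect writes are not admitted. -/
def Instr.realWithin (S : List ℕ) : Instr → Bool
  | .realZero a => S.contains a
  | .realAdd a _ _ => S.contains a
  | .realSub a _ _ => S.contains a
  | .realHalf a _ => S.contains a
  | .realLoad a _ => S.contains a
  | .realStore _ _ => false
  | .query a _ _ => S.contains a
  | _ => true

/-- All instructions of the program satisfy `f`. -/
def Prog.all (f : Instr → Bool) : Prog → Bool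
  | .skip => true
  | .instr i => f i
  | .seq P Q => P.all f && Q.all f
  | .ite _ P Q => P.all f && Q.all f
  | .while _ P => P.all f

/-- The unit in which the time of `d` nested loops is measured, if no query takes longer than `B`
in addition to its one step. -/
def timeUnit (n B d : ℕ) : ℕ := (n + 1) ^ d * (B + 5)

lemma one_le_timeUnit (n B d : ℕ) : 1 ≤ timeUnit n B d :=
  Nat.mul_pos (Nat.pow_pos (Nat.succ_pos n)) (by omega)

lemma timeUnit_le_succ (n B d : ℕ) : timeUnit n B d ≤ timeUnit n B (d + 1) := by
  rw [timeUnit, timeUnit, pow_succ, mul_assoc, mul_comm (n + 1), ← mul_assoc]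
  exact Nat.le_mul_of_pos_right _ (Nat.succ_pos n)

lemma loop_time_le (n B d k : ℕ) :
    n * (k * timeUnit n B d + B + 5) + B + 5 ≤ (k + 1) * timeUnit n B (d + 1) := by
  have h1 : B + 5 ≤ timeUnit n B d :=
    Nat.le_mul_of_pos_left _ (Nat.pow_pos (Nat.succ_pos n))
  calc n * (k * timeUnit n B d + B + 5) + B + 5
      ≤ (n + 1) * (k * timeUnit n B d + (B + 5)) := by ring_nf; omega
    _ ≤ (n + 1) * (k * timeUnit n B d + timeUnit n B d) :=
        Nat.mul_le_mul_left _ (add_le_add le_rfl h1)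
    _ = _ := by rw [timeUnit, timeUnit, pow_succ]; ring

section Hoare

variable {n : ℕ} (D : Fin n → Fin n → ℝ) (τ : Fin n → Fin n → ℕ)

/-- Started in the memory `m`, the program `P` ends after time at most `T`, in a memory that
satisfies `Q`. The programs `K` that are to be executed afterwards are not touched. -/
def Prog.Ends (P : Prog) (m : Memory) (T : ℕ) (Q : Memory → Prop) : Prop :=
  ∃ (N : ℕ) (m' : Memory) (t : ℕ), t ≤ T ∧ Q m' ∧
    ∀ K c, (Config.step D τ)^[N] ⟨P :: K, m, c⟩ = ⟨K, m', c + t⟩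

variable {D τ} {P P' : Prog} {m : Memory} {T T' : ℕ} {Q R : Memory → Prop}

lemma Prog.Ends.mono (h : P.Ends D τ m T Q) (hT : T ≤ T') (hQ : ∀ m', Q m' → R m') :
    P.Ends D τ m T' R := by
  obtain ⟨N, m', t, ht, hm', hN⟩ := h
  exact ⟨N, m', t, ht.trans hT, hQ _ hm', hN⟩

lemma Prog.Ends.imp (h : P.Ends D τ m T Q) (hQ : ∀ m', Q m' → R m') : P.Ends D τ m T R :=
  h.mono le_rfl hQ

lemma Prog.ends_skip (h : Q m) : Prog.skip.Ends D τ m 1 Q :=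
  ⟨1, m, 1, le_rfl, h, fun _ _ => rfl⟩

lemma Prog.Ends.seq (h : P.Ends D τ m T Q) (h' : ∀ m', Q m' → P'.Ends D τ m' T' R) :
    (Prog.seq P P').Ends D τ m (T + T' + 1) R := by
  obtain ⟨N, m', t, ht, hm', hN⟩ := h
  obtain ⟨N', m'', t', ht', hm'', hN'⟩ := h' m' hm'
  refine ⟨N' + (N + 1), m'', 1 + t + t', by omega, hm'', fun K c => ?_⟩
  rw [Function.iterate_add_apply, Function.iterate_succ_apply]
  change (Config.step D τ)^[N'] ((Config.step D τ)^[N] ⟨P :: P' :: K, m, c + 1⟩) = _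
  rw [hN, hN']
  congr 1
  omega

lemma Prog.Ends.ite {b : Test} (h : b.Holds m → P.Ends D τ m T Q)
    (h' : ¬ b.Holds m → P'.Ends D τ m T Q) : (Prog.ite b P P').Ends D τ m (T + 1) Q := by
  by_cases hb : b.Holds m
  · obtain ⟨N, m', t, ht, hm', hN⟩ := h hb
    refine ⟨N + 1, m', 1 + t, by omega, hm', fun K c => ?_⟩
    rw [Function.iterate_succ_apply, ← add_assoc, ← hN]
    simp only [Config.step, if_pos hb]
  · obtain ⟨N, m', t, ht, hm', hN⟩ := h' hb
    refine ⟨N + 1, m', 1 + t, by omega, hm', fun K c => ?_⟩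
    rw [Function.iterate_succ_apply, ← add_assoc, ← hN]
    simp only [Config.step, if_neg hb]

/-- A loop with the invariant `I`; each execution of the body decreases `μ`. -/
lemma Prog.Ends.while {b : Test} (I : Memory → Prop) (μ : Memory → ℕ)
    (h : ∀ m, I m → b.Holds m → P.Ends D τ m T fun m' => I m' ∧ μ m' < μ m) (hm : I m) :
    (Prog.while b P).Ends D τ m (μ m * (T + 1) + 1) fun m' => I m' ∧ ¬ b.Holds m' := by
  induction hk : μ m using Nat.strong_induction_on generalizing m with
  | _ k ih =>
    by_cases hb : b.Holds m
    · obtain ⟨N, m', t, ht, ⟨hm', hlt⟩, hN⟩ := h m hm hb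
      obtain ⟨N', m'', t', ht', hm'', hN'⟩ := ih (μ m') (hk ▸ hlt) hm' rfl
      refine ⟨N' + (N + 1), m'', 1 + t + t', ?_, hm'', fun K c => ?_⟩
      · have : (μ m' + 1) * (T + 1) ≤ k * (T + 1) := Nat.mul_le_mul_right _ (by omega)
        rw [add_mul] at this
        omega
      · rw [Function.iterate_add_apply, Function.iterate_succ_apply]
        simp only [Config.step, if_pos hb]
        rw [hN, hN']
        congr 1
        omega
    · refine ⟨1, m, 1, by omega, ⟨hm, hb⟩, fun K c => ?_⟩
      simp only [Function.iterate_one, Config.step, if_neg hb]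

lemma Instr.cost_le {B : ℕ} (hB : ∀ i j, τ i j ≤ B) (i : Instr) : i.cost τ m ≤ B + 1 := by
  cases i <;> simp only [Instr.cost] <;> try omega
  split_ifs with h
  · have := hB ⟨_, h.1⟩ ⟨_, h.2⟩
    omega
  · omega

lemma Prog.ends_block_length {B : ℕ} (hB : ∀ i j, τ i j ≤ B) (l : List Instr)
    (h : Q (l.foldl (fun m i => i.effect D m) m)) :
    (Prog.block l).Ends D τ m (l.length * (B + 2) + 1) Q := by
  induction l generalizing m with
  | nil => exact (Prog.ends_skip h).mono (by simp) fun _ h => h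
  | cons i l ih =>
    have h1 : (Prog.instr i).Ends D τ m (B + 1) fun m' => m' = i.effect D m :=
      ⟨1, _, _, Instr.cost_le hB i, rfl, fun _ _ => rfl⟩
    refine (h1.seq (P' := Prog.block l) (T' := l.length * (B + 2) + 1) (R := Q) ?_).mono
      (le_of_eq ?_) fun _ h => h
    · rintro _ rfl
      exact ih h
    · rw [List.length_cons]; ring

lemma Prog.ends_block {B : ℕ} (hB : ∀ i j, τ i j ≤ B) (l : List Instr)
    {k : ℕ} (hk : l.length + 1 ≤ k) (h : Q (l.foldl (fun m i => i.effect D m) m)) :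
    (Prog.block l).Ends D τ m (k * timeUnit n B 0) Q := by
  refine (Prog.ends_block_length hB l h).mono ?_ fun _ h => h
  rw [timeUnit, pow_zero, one_mul]
  refine le_trans ?_ (Nat.mul_le_mul_right _ hk)
  rw [add_mul]
  exact add_le_add (Nat.mul_le_mul_left _ (by omega)) (by omega)

lemma Prog.all_step {f : Instr → Bool} (c : Config) (h : ∀ P ∈ c.todo, P.all f = true) :
    ∀ P ∈ (c.step D τ).todo, P.all f = true := by
  rcases c with ⟨_ | ⟨P, K⟩, m, t⟩
  · exact h
  have hP : P.all f = true := h P (by simp)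
  have hK : ∀ P ∈ K, P.all f = true := fun P hP => h P (by simp [hP])
  rcases P with _ | i | ⟨P, Q⟩ | ⟨b, P, Q⟩ | ⟨b, P⟩
  · exact hK
  · exact hK
  · simp only [Prog.all, Bool.and_eq_true] at hP
    simpa [Config.step, hP] using hK
  · simp only [Prog.all, Bool.and_eq_true] at hP
    simp only [Config.step]
    split_ifs <;> simpa [hP] using hK
  · simp only [Prog.all] at hP
    simp only [Config.step]
    split_ifs
    · simpa [hP, Prog.all] using hK
    · exact hK

/-- A relation between memories that every instruction of the program respects holds between the
memories before and after its execution. -/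
lemma Prog.Ends.frame {f : Instr → Bool} (Rel : Memory → Memory → Prop)
    (hrefl : ∀ m, Rel m m) (htrans : ∀ m m' m'', Rel m m' → Rel m' m'' → Rel m m'')
    (hf : ∀ i, f i = true → ∀ m, Rel m (i.effect D m)) (hP : P.all f = true)
    (h : P.Ends D τ m T Q) : P.Ends D τ m T fun m' => Q m' ∧ Rel m m' := by
  obtain ⟨N, m', t, ht, hm', hN⟩ := h
  refine ⟨N, m', t, ht, ⟨hm', ?_⟩, hN⟩
  have hstep : ∀ c : Config, (∀ P ∈ c.todo, P.all f = true) → Rel c.mem (c.step D τ).mem := by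
    rintro ⟨_ | ⟨P, K⟩, m, t⟩ h
    · exact hrefl _
    cases P with
    | instr i => exact hf i (h (.instr i) (by simp)) m
    | _ => exact hrefl _
  have hall : ∀ N, (∀ R ∈ ((Config.step D τ)^[N] ⟨[P], m, 0⟩).todo, R.all f = true) ∧
      Rel m ((Config.step D τ)^[N] ⟨[P], m, 0⟩).mem := by
    intro N
    induction N with
    | zero => exact ⟨by simpa using hP, hrefl _⟩
    | succ N ih =>
      rw [Function.iterate_succ_apply']
      exact ⟨Prog.all_step _ ih.1, htrans _ _ _ ih.2 (hstep _ ih.1)⟩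
  have := (hall N).2
  rwa [hN] at this

lemma Prog.Ends.frame_nat (S : List ℕ) (hP : P.all (Instr.natWithin S) = true)
    (h : P.Ends D τ m T Q) :
    P.Ends D τ m T fun m' => Q m' ∧ ∀ a ∉ S, m'.nat a = m.nat a := by
  refine h.frame (fun m m' => ∀ a ∉ S, m'.nat a = m.nat a) (fun _ _ _ => rfl)
    (fun _ _ _ h h' a ha => (h' a ha).trans (h a ha)) (fun i hi m a ha => ?_) hP
  cases i <;> simp only [Instr.natWithin, List.contains_iff_mem] at hi <;>
    simp only [Instr.effect, Memory.setNat_nat, Memory.setReal_nat] <;>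
    first
    | rfl
    | (rw [if_neg]; rintro rfl; exact ha hi)
    | exact absurd hi (by decide)

lemma Prog.Ends.frame_real (S : List ℕ) (hP : P.all (Instr.realWithin S) = true)
    (h : P.Ends D τ m T Q) :
    P.Ends D τ m T fun m' => Q m' ∧ ∀ a ∉ S, m'.real a = m.real a := by
  refine h.frame (fun m m' => ∀ a ∉ S, m'.real a = m.real a) (fun _ _ _ => rfl)
    (fun _ _ _ h h' a ha => (h' a ha).trans (h a ha)) (fun i hi m a ha => ?_) hP
  cases i <;> simp only [Instr.realWithin, List.contains_iff_mem] at hi <;>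
    simp only [Instr.effect, Memory.setReal_real, Memory.setNat_real] <;>
    first
    | rfl
    | (rw [if_neg]; rintro rfl; exact ha hi)
    | exact absurd hi (by decide)

/-- A `for` loop with the invariant `I k` before the `k`-th execution of the body. In the body, the
loop counter and the registers that the loop does not change are known. -/
lemma Prog.Ends.forBelow {B : ℕ} (hB : ∀ i j, τ i j ≤ B) {i c d : ℕ} (S : List ℕ)
    (hP : P.all (Instr.natWithin S) = true) (hS : (0 ∉ S ∧ 1 ∉ S ∧ i ∉ S) ∧ i ≠ 0 ∧ i ≠ 1)
    (h0 : m.nat 0 = n) (h1 : m.nat 1 = 1) (I : ℕ → Memory → Prop) (hI : I 0 (m.setNat i 0))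
    (h : ∀ k < n, ∀ m', (∀ a ∉ i :: S, m'.nat a = m.nat a) → m'.nat i = k → I k m' →
      P.Ends D τ m' (c * timeUnit n B d) fun m' => I (k + 1) (m'.setNat i (k + 1))) :
    (Prog.forBelow i P).Ends D τ m ((c + 1) * timeUnit n B (d + 1))
      fun m' => I n m' ∧ ∀ a ∉ i :: S, m'.nat a = m.nat a := by
  obtain ⟨⟨h0S, h1S, hiS⟩, hi0, hi1⟩ := hS
  have hle := loop_time_le n B d c
  generalize c * timeUnit n B d = T at h hle
  refine ((Prog.ends_block_length (Q := fun m' => m' = m.setNat i 0) hB [.natConst i 0] rfl).seq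
    (P' := .while (.natLt i 0) (.seq P (.block [.natAdd i i 1])))
    (T' := n * (T + B + 5) + 1) ?_).mono
    (le_trans (by simp; omega) hle) fun _ h => h
  rintro _ rfl
  have hloop := Prog.Ends.while (D := D) (τ := τ) (b := .natLt i 0)
    (P := .seq P (.block [.natAdd i i 1])) (T := T + B + 4) (m := m.setNat i 0)
    (fun m' => m'.nat i ≤ n ∧ I (m'.nat i) m' ∧ ∀ a ∉ i :: S, m'.nat a = m.nat a)
    (fun m' => n - m'.nat i) ?_ ?_
  · refine hloop.mono ?_ ?_
    · simp [add_assoc]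
    · rintro m' ⟨⟨hle, hI', hfr⟩, hb⟩
      have h0' := hfr 0 (by simp [hi0.symm, h0S])
      simp only [Test.Holds, h0', h0, not_lt] at hb
      rw [le_antisymm hle hb] at hI'
      exact ⟨hI', hfr⟩
  · rintro m' ⟨hle, hI', hfr⟩ hb
    have h0' := hfr 0 (by simp [hi0.symm, h0S])
    have h1' := hfr 1 (by simp [hi1.symm, h1S])
    simp only [Test.Holds, h0', h0] at hb
    refine (((h _ hb m' hfr rfl hI').frame_nat S hP).seq (T' := B + 3) ?_).mono
      (by omega) fun _ h => h
    rintro m'' ⟨hI'', hfr''⟩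
    refine (Prog.ends_block_length hB [.natAdd i i 1] ?_).mono (by simp) fun _ h => h
    have hi : m''.nat i = m'.nat i := hfr'' i hiS
    have h1'' : m''.nat 1 = 1 := by rw [hfr'' 1 h1S, h1', h1]
    simp only [List.foldl_cons, List.foldl_nil, Instr.effect, hi, h1'', Memory.setNat_nat, if_true]
    refine ⟨⟨hb, hI'', fun a ha => ?_⟩, by omega⟩
    have ha' : a ≠ i ∧ a ∉ S := by simpa using ha
    rw [if_neg ha'.1, hfr'' a ha'.2, hfr a ha]
  · refine ⟨by simp, by simpa using hI, fun a ha => ?_⟩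
    have ha' : a ≠ i ∧ a ∉ S := by simpa using ha
    simp [ha'.1]

/-- The `for` loop with a body that does not write indirectly: the real registers that the loop
does not change are known in the body, too. -/
lemma Prog.Ends.forBelow_real {B : ℕ} (hB : ∀ i j, τ i j ≤ B) {i c d : ℕ} (S S' : List ℕ)
    (hP : P.all (Instr.natWithin S) = true) (hP' : P.all (Instr.realWithin S') = true)
    (hS : (0 ∉ S ∧ 1 ∉ S ∧ i ∉ S) ∧ i ≠ 0 ∧ i ≠ 1)
    (h0 : m.nat 0 = n) (h1 : m.nat 1 = 1) (I : ℕ → Memory → Prop) (hI : I 0 (m.setNat i 0))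
    (h : ∀ k < n, ∀ m', (∀ a ∉ i :: S, m'.nat a = m.nat a) → (∀ a ∉ S', m'.real a = m.real a) →
      m'.nat i = k → I k m' →
        P.Ends D τ m' (c * timeUnit n B d) fun m' => I (k + 1) (m'.setNat i (k + 1))) :
    (Prog.forBelow i P).Ends D τ m ((c + 1) * timeUnit n B (d + 1))
      fun m' => I n m' ∧ (∀ a ∉ i :: S, m'.nat a = m.nat a) ∧ ∀ a ∉ S', m'.real a = m.real a := by
  refine (Prog.Ends.forBelow hB S hP hS h0 h1
    (fun k m' => I k m' ∧ ∀ a ∉ S', m'.real a = m.real a) ⟨hI, fun _ _ => rfl⟩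
    fun k hk m' hn hk' hI' => ?_).imp fun m' h => ⟨h.1.1, h.2, h.1.2⟩
  refine ((h k hk m' hn hI'.2 hk' hI'.1).frame_real S' hP').imp fun m'' h => ⟨h.1, fun a ha => ?_⟩
  rw [← hI'.2 a ha, ← h.2 a ha]
  rfl

end Hoare

/-! ### Greedy selection -/

section Greedy

variable {X : Type*} [MetricSpace X] {r : ℝ} {f : X → ℝ} {x : X} {i : ℕ} {W : X → ℝ} {v : ℝ}

/-- The state of the greedy selection in the ball of radius `r` around `x` after `i` rounds. The
points `c 0, …, c (m - 1)` have been selected, in the order of decreasing `f`, and with each one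
the points within distance `r / 32` have been removed; `idx z` tells which selection removed `z`.
The weight `W z` is `f z + r` for the points that are left and `0` for the others; `v` is the value
found so far. A round in which no positive weight is left does nothing. -/
def IsGreedy (r : ℝ) (f : X → ℝ) (x : X) (i : ℕ) (W : X → ℝ) (v : ℝ) : Prop :=
  0 ≤ v ∧ (∀ z, r < dist x z → W z = 0) ∧
  ∃ (m : ℕ) (c : ℕ → X) (idx : X → ℕ), (m = i ∨ ∀ z, W z ≤ 0) ∧
    (∀ k < m, dist x (c k) ≤ r) ∧
    (∀ k < m, ∀ l < k, r / 32 < dist (c l) (c k) ∧ f (c k) ≤ f (c l)) ∧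
    (∀ z, dist x z ≤ r →
      (W z = f z + r ∧ ∀ k < m, r / 32 < dist (c k) z ∧ f z ≤ f (c k)) ∨
      (W z = 0 ∧ idx z < m ∧ dist (c (idx z)) z ≤ r / 32 ∧ f z + r * 2 ^ level (idx z) ≤ v)) ∧
    (v ≤ 0 ∨ ∃ k < m, v ≤ f (c k) + 2 * r * 2 ^ level k)

lemma isGreedy_zero (hW : ∀ z, W z = if r < dist x z then 0 else f z + r) :
    IsGreedy r f x 0 W 0 := by
  refine ⟨le_rfl, fun z hz => by rw [hW, if_pos hz], 0, fun _ => x, fun _ => 0, Or.inl rfl, by simp,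
    by simp, fun z hz => Or.inl ⟨by rw [hW, if_neg (not_lt.2 hz)], by simp⟩, Or.inl le_rfl⟩

lemma IsGreedy.idle (h : IsGreedy r f x i W v) (hW : ∀ z, W z ≤ 0) :
    IsGreedy r f x (i + 1) W v := by
  obtain ⟨h1, h2, m, c, idx, -, h⟩ := h
  exact ⟨h1, h2, m, c, idx, Or.inr hW, h⟩

lemma IsGreedy.pick (h : IsGreedy r f x i W v) (hr : 0 ≤ r) {u : X} (hu : 0 < W u)
    (hmax : ∀ z, W z ≤ W u) :
    IsGreedy r f x (i + 1) (fun z => if r / 32 < dist u z then W z else 0)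
      (max v (W u + r * 2 ^ level i)) := by
  classical
  obtain ⟨hv, hout, m, c, idx, hm, hball, hsep, hin, hpack⟩ := h
  obtain rfl : m = i := hm.resolve_right fun h => absurd (h u) (not_le.2 hu)
  have hux : dist x u ≤ r := by
    by_contra! h
    rw [hout u h] at hu
    exact lt_irrefl _ hu
  obtain ⟨hWu, hun⟩ := (hin u hux).resolve_right fun h => hu.ne' h.1
  have hc : ∀ k < m, Function.update c m u k = c k := fun k hk =>
    Function.update_of_ne hk.ne _ _
  have hcm : Function.update c m u m = u := Function.update_self ..
  refine ⟨hv.trans (le_max_left _ _), fun z hz => by simp [hout z hz], m + 1,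
    Function.update c m u, fun z => if ∀ k < m, r / 32 < dist (c k) z then m else idx z,
    Or.inl rfl, fun k hk => ?_, fun k hk l hl => ?_, fun z hz => ?_, ?_⟩
  · rcases Nat.lt_succ_iff_lt_or_eq.1 hk with hk | rfl
    · rw [hc k hk]; exact hball k hk
    · rwa [hcm]
  · rw [hc l (by omega)]
    rcases Nat.lt_succ_iff_lt_or_eq.1 hk with hk | rfl
    · rw [hc k hk]; exact hsep k hk l hl
    · rw [hcm]; exact hun l hl
  · rcases hin z hz with ⟨hWz, hz'⟩ | ⟨hWz, hzm, hzd, hzv⟩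
    · have hfz : f z ≤ f u := by have := hmax z; linarith
      by_cases hd : r / 32 < dist u z
      · refine Or.inl ⟨(if_pos hd).trans hWz, fun k hk => ?_⟩
        rcases Nat.lt_succ_iff_lt_or_eq.1 hk with hk | rfl
        · rw [hc k hk]; exact hz' k hk
        · rw [hcm]; exact ⟨hd, hfz⟩
      · refine Or.inr ⟨if_neg hd, ?_⟩
        simp only [if_pos fun k hk => (hz' k hk).1]
        rw [hcm]
        exact ⟨Nat.lt_succ_self _, not_lt.1 hd, le_max_of_le_right (by linarith)⟩
    · have hidx : ¬ ∀ k < m, r / 32 < dist (c k) z := fun h => (h _ hzm).not_ge hzd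
      refine Or.inr ⟨by simp [hWz], ?_⟩
      simp only [if_neg hidx]
      rw [hc _ hzm]
      exact ⟨by omega, hzd, le_max_of_le_left hzv⟩
  · rcases le_total v (W u + r * 2 ^ level m) with h | h
    · refine Or.inr ⟨m, Nat.lt_succ_self m, ?_⟩
      rw [max_eq_right h, hcm, hWu]
      have : r * 1 ≤ r * 2 ^ level m :=
        mul_le_mul_of_nonneg_left (one_le_pow₀ (by norm_num)) hr
      linarith
    · rw [max_eq_left h]
      refine hpack.imp id ?_
      rintro ⟨k, hk, hkv⟩
      exact ⟨k, by omega, by rwa [hc k hk]⟩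

/-- After as many rounds as there are points, the value is final. -/
lemma IsGreedy.isEntry [Fintype X] (h : IsGreedy r f x (Fintype.card X) W v) (hr : 0 ≤ r)
    (hf : ∀ z, 0 ≤ f z) : IsEntry r f x v := by
  obtain ⟨hv, hout, m, c, idx, hm, hball, hsep, hin, hpack⟩ := h
  -- nothing is left: otherwise all points have been selected
  have hW : ∀ z, W z ≤ 0 := by
    refine hm.elim (fun hm z => ?_) id
    subst hm
    have hinj : Function.Injective fun k : Fin (Fintype.card X) => c k := by
      have hne : ∀ k l : Fin (Fintype.card X), l < k → c l ≠ c k := fun k l hlk h => by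
        have := (hsep k k.2 l hlk).1
        rw [h, dist_self] at this
        linarith
      intro k l hkl
      by_contra h
      rcases lt_or_gt_of_ne h with h | h
      · exact hne _ _ h hkl
      · exact hne _ _ h hkl.symm
    obtain ⟨k, hk⟩ := ((Fintype.bijective_iff_injective_and_card _).2 ⟨hinj, by simp⟩).2 z
    simp only at hk
    by_cases hz : dist x z ≤ r
    · rcases hin z hz with ⟨-, h⟩ | ⟨h, -⟩
      · have := (h k k.2).1
        rw [hk, dist_self] at this
        linarith
      · exact h.le
    · exact (hout z (not_le.1 hz)).le
  refine ⟨hv, ⟨idx, fun z z' hz hz' hzz => ?_, fun z hz => ?_⟩, hpack.imp id ?_⟩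
  · rcases hin z hz, hin z' hz' with ⟨⟨h, -⟩ | ⟨-, -, h, -⟩, ⟨h', -⟩ | ⟨-, -, h', -⟩⟩
    on_goal 4 =>
      rw [← hzz] at h'
      have := dist_triangle_left z z' (c (idx z))
      linarith
    -- a point is left only if `r = 0`
    all_goals
      have h0 : r = 0 := by
        first
        | linarith [hW z, hf z]
        | linarith [hW z', hf z']
      subst h0
      have := dist_triangle_left z z' x
      linarith
  · rcases hin z hz with ⟨h, -⟩ | ⟨-, -, -, h⟩
    · have h0 : r = 0 := by linarith [hW z, hf z]
      subst h0
      linarith [hW z]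
    · exact h
  · rintro ⟨i, hi, hvi⟩
    refine ⟨i, c, fun k hk => ⟨hball k (by omega), hvi.trans ?_⟩, fun k hk l hl hkl => ?_⟩
    · rcases hk.lt_or_eq with hk | rfl
      · linarith [(hsep i hi k hk).2]
      · exact le_rfl
    · rcases lt_or_gt_of_ne hkl with h | h
      · exact (hsep l (by omega) k h).1
      · rw [dist_comm]; exact (hsep k (by omega) l h).1

/-- The entries of a row whose scale is `0` are `0`. -/
lemma isEntry_zero (x : X) : IsEntry 0 (fun _ => 0) x 0 := by
  refine ⟨le_rfl, ⟨fun _ => 0, fun z z' hz hz' _ => ?_, fun z _ => by simp⟩, Or.inl le_rfl⟩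
  have := dist_triangle_left z z' x
  linarith

end Greedy

/-! ### Memory layout -/

lemma effect_natConst {n : ℕ} (D : Fin n → Fin n → ℝ) (a v : ℕ) (m : Memory) :
    (Instr.natConst a v).effect D m = m.setNat a v := rfl
lemma effect_natAdd {n : ℕ} (D : Fin n → Fin n → ℝ) (a b c : ℕ) (m : Memory) :
    (Instr.natAdd a b c).effect D m = m.setNat a (m.nat b + m.nat c) := rfl
lemma effect_natSub {n : ℕ} (D : Fin n → Fin n → ℝ) (a b c : ℕ) (m : Memory) :
    (Instr.natSub a b c).effect D m = m.setNat a (m.nat b - m.nat c) := rfl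
lemma effect_realZero {n : ℕ} (D : Fin n → Fin n → ℝ) (a : ℕ) (m : Memory) :
    (Instr.realZero a).effect D m = m.setReal a 0 := rfl
lemma effect_realAdd {n : ℕ} (D : Fin n → Fin n → ℝ) (a b c : ℕ) (m : Memory) :
    (Instr.realAdd a b c).effect D m = m.setReal a (m.real b + m.real c) := rfl
lemma effect_realHalf {n : ℕ} (D : Fin n → Fin n → ℝ) (a b : ℕ) (m : Memory) :
    (Instr.realHalf a b).effect D m = m.setReal a (m.real b / 2) := rfl
lemma effect_realLoad {n : ℕ} (D : Fin n → Fin n → ℝ) (a b : ℕ) (m : Memory) :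
    (Instr.realLoad a b).effect D m = m.setReal a (m.real (m.nat b)) := rfl
lemma effect_realStore {n : ℕ} (D : Fin n → Fin n → ℝ) (a b : ℕ) (m : Memory) :
    (Instr.realStore a b).effect D m = m.setReal (m.nat a) (m.real b) := rfl
lemma effect_query {n : ℕ} (D : Fin n → Fin n → ℝ) (a b c : ℕ) (m : Memory) :
    (Instr.query a b c).effect D m = m.setReal a (pairDist D (m.nat b) (m.nat c)) := rfl

attribute [simp] effect_natConst effect_natAdd effect_natSub effect_realZero effect_realAdd
  effect_realHalf effect_realLoad effect_realStore effect_query Test.Holds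

/-- The registers that keep their values after the initialization. -/
structure HasConstants (n : ℕ) (m : Memory) : Prop where
  size : m.nat 0 = n
  one : m.nat 1 = 1
  weights : m.nat 2 = 16
  stride : m.nat 3 = n + 1
  rows : m.nat 4 = 16 + n
  zero : m.nat 16 = 0
  realZero : m.real 1 = 0

lemma HasConstants.of_eq {n : ℕ} {m m' : Memory} (h : HasConstants n m) {S : List ℕ}
    (hn : ∀ a ∉ S, m'.nat a = m.nat a) (hr : m'.real 1 = m.real 1)
    (hS : (0 ∉ S ∧ 1 ∉ S ∧ 2 ∉ S) ∧ 3 ∉ S ∧ 4 ∉ S ∧ 16 ∉ S) : HasConstants n m' :=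
  ⟨(hn _ hS.1.1).trans h.size, (hn _ hS.1.2.1).trans h.one, (hn _ hS.1.2.2).trans h.weights,
    (hn _ hS.2.1).trans h.stride, (hn _ hS.2.2.1).trans h.rows, (hn _ hS.2.2.2).trans h.zero,
    hr.trans h.realZero⟩

/-- The real registers agree outside the registers in `S` and the `n` registers for the weights. -/
def AgreeOff (n : ℕ) (S : List ℕ) (m m' : Memory) : Prop :=
  ∀ a ∉ S, a < 16 ∨ 16 + n ≤ a → m'.real a = m.real a

lemma AgreeOff.trans {n : ℕ} {S S' S'' : List ℕ} {m m' m'' : Memory} (h : AgreeOff n S m m')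
    (h' : AgreeOff n S' m' m'') (hS : S ⊆ S'') (hS' : S' ⊆ S'') : AgreeOff n S'' m m'' :=
  fun a ha ha' => (h' a (fun h => ha (hS' h)) ha').trans (h a (fun h => ha (hS h)) ha')

section Points

variable {n : ℕ} {X : Type*} (e : Fin n ≃ X)

/-- The number of a point. -/
def pointNum (x : X) : ℕ := e.symm x

lemma pointNum_lt (x : X) : pointNum e x < n := (e.symm x).2

@[simp] lemma pointNum_inj {x y : X} : pointNum e x = pointNum e y ↔ x = y := by
  simp [pointNum, Fin.val_inj]

lemma exists_pointNum {k : ℕ} (hk : k < n) : ∃ x, pointNum e x = k :=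
  ⟨e ⟨k, hk⟩, by simp [pointNum]⟩

@[simp] lemma pairDist_pointNum [MetricSpace X] (x y : X) :
    pairDist (fun i j => dist (e i) (e j)) (pointNum e x) (pointNum e y) = dist x y := by
  rw [pairDist, dif_pos ⟨pointNum_lt e x, pointNum_lt e y⟩]
  simp [pointNum]

end Points

/-! ### The program for one entry of the table -/

/-- Find a point `N[12]` of largest weight, and this weight `R[7]`. -/
def findBest : Prog :=
  .seq (.block [.realZero 7])
    (.forBelow 8 (.seq (.block [.natAdd 10 2 8, .realLoad 9 10])
      (.ite (.realLt 7 9) (.block [.realAdd 7 9 1, .natAdd 12 8 16]) .skip)))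

/-- Set the weights of all points within distance `R[5]` of the point `N[12]` to `0`. -/
def removeBall : Prog :=
  .forBelow 8 (.seq (.block [.query 4 12 8])
    (.ite (.realLt 5 4) .skip (.block [.natAdd 10 2 8, .realStore 10 1])))

/-- Initialize the weights for the ball of radius `R[3]` around the point `N[7]`. -/
def initWeights : Prog :=
  .forBelow 8 (.seq (.block [.query 4 7 8, .natAdd 10 2 8])
    (.ite (.realLt 3 4) (.block [.realStore 10 1])
      (.block [.natAdd 9 6 8, .realLoad 9 9, .realAdd 9 9 3, .realStore 10 9])))

/-- Adapt `N[13] = 2 ^ e`, `N[14] = e`, `N[15] = 4 ^ a` and `R[6] = 2 ^ a R[3]`, where `a` is the level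
of `N[11]` and `N[11] < 2 ^ e`, to the next value of `N[11]`. -/
def nextLevel : Prog :=
  .seq (.block [.natAdd 10 11 1])
    (.ite (.natLt 10 13) .skip
      (.seq (.block [.natAdd 13 13 13])
        (.ite (.natLt 14 15) (.block [.natAdd 14 14 1])
          (.block [.natAdd 14 14 1, .natAdd 15 15 15, .natAdd 15 15 15, .realAdd 6 6 6]))))

/-- One round of the greedy selection; the value found so far is `R[8]`. -/
def greedyRound : Prog :=
  .seq findBest
    (.ite (.realLt 1 7)
      (.seq (.block [.realAdd 9 7 6])
        (.seq (.ite (.realLt 8 9) (.block [.realAdd 8 9 1]) .skip) removeBall))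
      .skip)

/-- Compute the entry for the point `N[7]` in the row that starts at `N[5]`. -/
def tableEntry : Prog :=
  .seq initWeights
    (.seq (.block [.realZero 8, .realAdd 6 3 1, .natConst 13 1, .natConst 14 0, .natConst 15 1])
      (.seq (.forBelow 11 (.seq greedyRound nextLevel))
        (.block [.natAdd 10 5 1, .natAdd 10 10 7, .realStore 10 8])))

section Entry

variable {n : ℕ} {X : Type*} [MetricSpace X] {e : Fin n ≃ X} {τ : Fin n → Fin n → ℕ} {B : ℕ}
  {m : Memory} {W : X → ℝ}

lemma findBest_ends (hB : ∀ i j, τ i j ≤ B) (hm : HasConstants n m)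
    (hW : ∀ x, m.real (16 + pointNum e x) = W x) :
    findBest.Ends (fun i j => dist (e i) (e j)) τ m (15 * timeUnit n B 1) fun m' =>
      (0 ≤ m'.real 7 ∧ (∀ x, W x ≤ m'.real 7) ∧
        (0 < m'.real 7 → ∃ u, m'.nat 12 = pointNum e u ∧ W u = m'.real 7)) ∧
      (∀ a ∉ [8, 10, 12], m'.nat a = m.nat a) ∧ ∀ a ∉ [7, 9], m'.real a = m.real a := by
  have ht : timeUnit n B 0 ≤ timeUnit n B 1 := timeUnit_le_succ n B 0
  have ht1 := one_le_timeUnit n B 0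
  refine Prog.Ends.mono (Prog.Ends.seq (Prog.ends_block (k := 2)
    (Q := fun m' => m' = m.setReal 7 0) hB _ (by decide) rfl)
    (T' := 12 * timeUnit n B 1) ?_) (by omega) fun _ h => h
  rintro _ rfl
  refine Prog.Ends.mono (Prog.Ends.forBelow_real (m := m.setReal 7 0) hB (c := 10) (d := 0)
    [10, 12] [7, 9] (by decide)
    (by decide) (by decide) hm.size hm.one
    (fun k m' => 0 ≤ m'.real 7 ∧ (∀ x, pointNum e x < k → W x ≤ m'.real 7) ∧
      (0 < m'.real 7 → ∃ u, m'.nat 12 = pointNum e u ∧ W u = m'.real 7)) (by simp) ?_)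
    (by simp only [zero_add]; omega) ?_
  · intro k hk m' hn hr h8 hI
    obtain ⟨y, rfl⟩ := exists_pointNum e hk
    refine Prog.Ends.mono (Prog.Ends.seq (Prog.ends_block (k := 3)
      (Q := fun m'' => m'' = (m'.setNat 10 (16 + pointNum e y)).setReal 9 (W y)) hB _ (by decide) ?_)
      (T' := 4 * timeUnit n B 0) ?_) (by omega) fun _ h => h
    · have h2 : m'.nat 2 = 16 := (hn 2 (by decide)).trans (by simp [hm.weights])
      have hy : m'.real (16 + pointNum e y) = W y :=
        (hr _ (by simp; omega)).trans (by simp [hW]; omega)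
      simp [h2, h8, hy]
    have h1 : m'.real 1 = 0 := (hr 1 (by decide)).trans (by simp [hm.realZero])
    have h16 : m'.nat 16 = 0 := (hn 16 (by decide)).trans (by simp [hm.zero])
    obtain ⟨hI1, hI2, hI3⟩ := hI
    rintro _ rfl
    refine Prog.Ends.mono (Prog.Ends.ite (fun hlt => Prog.ends_block (k := 3) hB _ (by decide) ?_)
      (fun hlt => Prog.Ends.mono (Prog.ends_skip ?_) (by omega) fun _ h => h)) (by omega)
      fun _ h => h
    · simp only [Test.Holds, Memory.setReal_real, Memory.setNat_real, Nat.reduceEqDiff, if_false,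
        if_true] at hlt
      simp only [Nat.lt_succ_iff_lt_or_eq]
      simp [h1, h16, h8]
      refine ⟨hI1.trans hlt.le, ?_⟩
      rintro x (hx | rfl)
      · exact (hI2 x hx).trans hlt.le
      · exact le_rfl
    · simp only [Test.Holds, Memory.setReal_real, Memory.setNat_real, Nat.reduceEqDiff, if_false,
        if_true, not_lt] at hlt
      simp only [Nat.lt_succ_iff_lt_or_eq]
      simp
      refine ⟨hI1, ?_, hI3⟩
      rintro x (hx | rfl)
      · exact hI2 x hx
      · exact hlt
  · rintro m' ⟨⟨h1, h2, h3⟩, hn, hr⟩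
    refine ⟨⟨h1, fun x => h2 x (pointNum_lt e x), h3⟩, fun a ha => (hn a ha).trans rfl, ?_⟩
    intro a ha
    rw [hr a ha]
    have : a ≠ 7 := by rintro rfl; simp at ha
    simp [this]

lemma removeBall_ends (hB : ∀ i j, τ i j ≤ B) (hm : HasConstants n m) {u : X}
    (hu : m.nat 12 = pointNum e u) (hW : ∀ x, m.real (16 + pointNum e x) = W x) :
    removeBall.Ends (fun i j => dist (e i) (e j)) τ m (12 * timeUnit n B 1) fun m' =>
      (∀ x, m'.real (16 + pointNum e x) = if m.real 5 < dist u x then W x else 0) ∧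
      (∀ a ∉ [8, 10], m'.nat a = m.nat a) ∧ AgreeOff n [4] m m' := by
  have ht1 := one_le_timeUnit n B 0
  refine Prog.Ends.mono (Prog.Ends.forBelow (m := m) hB (c := 10) (d := 0) [10] (by decide)
    (by decide) hm.size hm.one
    (fun k m' => (∀ x, m'.real (16 + pointNum e x) =
      if pointNum e x < k then if m.real 5 < dist u x then W x else 0 else W x) ∧
      AgreeOff n [4] m m') (by simp [hW, AgreeOff]) ?_) (by simp only [zero_add]; omega) ?_
  · rintro k hk m' hn h8 ⟨hI, hr⟩
    obtain ⟨y, rfl⟩ := exists_pointNum e hk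
    have h2 : m'.nat 2 = 16 := (hn 2 (by decide)).trans hm.weights
    have h12 : m'.nat 12 = pointNum e u := (hn 12 (by decide)).trans hu
    have h1 : m'.real 1 = 0 := (hr 1 (by decide) (by omega)).trans hm.realZero
    have h5 : m'.real 5 = m.real 5 := hr 5 (by decide) (by omega)
    have hiff : ∀ x, x ≠ y → (pointNum e x ≤ pointNum e y ↔ pointNum e x < pointNum e y) :=
      fun x hxy => (lt_iff_le_and_ne.trans (and_iff_left (mt (pointNum_inj e).1 hxy))).symm
    refine Prog.Ends.mono (Prog.Ends.seq (Prog.ends_block (k := 3)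
      (Q := fun m'' => m'' = m'.setReal 4 (dist u y)) hB _ (by decide) (by simp [h12, h8]))
      (T' := 4 * timeUnit n B 0) ?_) (by omega) fun _ h => h
    rintro _ rfl
    refine Prog.Ends.mono (Prog.Ends.ite
      (fun hlt => Prog.Ends.mono (Prog.ends_skip ?_) (by omega) fun _ h => h)
      (fun hlt => Prog.ends_block (k := 3) hB _ (by decide) ?_)) (by omega) fun _ h => h
    · simp only [Test.Holds, Memory.setReal_real, Nat.reduceEqDiff, if_false, if_true, h5] at hlt
      refine ⟨fun x => ?_, fun a ha ha' => ?_⟩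
      · have hx : 16 + pointNum e x ≠ 4 := by omega
        by_cases hxy : x = y
        · subst hxy; simp [hlt, hx, hI]
        · simp [hx, hI, hiff x hxy]
      · have : a ≠ 4 := by simpa using ha
        simp [this, hr a ha ha']
    · simp only [Test.Holds, Memory.setReal_real, Nat.reduceEqDiff, if_false, if_true, h5] at hlt
      refine ⟨fun x => ?_, fun a ha ha' => ?_⟩
      · have hx : 16 + pointNum e x ≠ 4 := by omega
        by_cases hxy : x = y
        · subst hxy; simp [hlt, h2, h8, h1]
        · simp [hxy, hI, h2, h8, hx, hiff x hxy]
      · have : a ≠ 4 := by simpa using ha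
        have hay : a ≠ 16 + pointNum e y := by omega
        simp [this, hay, h2, h8, hr a ha ha']
  · rintro m' ⟨⟨h, hr⟩, hn⟩
    exact ⟨fun x => by rw [h x, if_pos (pointNum_lt e x)], hn, hr⟩

lemma initWeights_ends (hB : ∀ i j, τ i j ≤ B) (hm : HasConstants n m) {x : X}
    (hx : m.nat 7 = pointNum e x) (h6 : 16 + n ≤ m.nat 6) :
    initWeights.Ends (fun i j => dist (e i) (e j)) τ m (20 * timeUnit n B 1) fun m' =>
      (∀ z, m'.real (16 + pointNum e z) =
        if m.real 3 < dist x z then 0 else m.real (m.nat 6 + pointNum e z) + m.real 3) ∧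
      (∀ a ∉ [8, 9, 10], m'.nat a = m.nat a) ∧ AgreeOff n [4, 9] m m' := by
  have ht1 := one_le_timeUnit n B 0
  refine Prog.Ends.mono (Prog.Ends.forBelow (m := m) hB (c := 15) (d := 0) [9, 10] (by decide)
    (by decide) hm.size hm.one
    (fun k m' => (∀ z, pointNum e z < k → m'.real (16 + pointNum e z) =
        if m.real 3 < dist x z then 0 else m.real (m.nat 6 + pointNum e z) + m.real 3) ∧
      AgreeOff n [4, 9] m m') (by simp [AgreeOff]) ?_) (by simp only [zero_add]; omega) ?_
  · rintro k hk m' hn h8 ⟨hI, hr⟩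
    obtain ⟨y, rfl⟩ := exists_pointNum e hk
    have hy := pointNum_lt e y
    have h2 : m'.nat 2 = 16 := (hn 2 (by decide)).trans hm.weights
    have h6' : m'.nat 6 = m.nat 6 := hn 6 (by decide)
    have h7 : m'.nat 7 = pointNum e x := (hn 7 (by decide)).trans hx
    have h1 : m'.real 1 = 0 := (hr 1 (by decide) (by omega)).trans hm.realZero
    have h3 : m'.real 3 = m.real 3 := hr 3 (by decide) (by omega)
    have hf : m'.real (m.nat 6 + pointNum e y) = m.real (m.nat 6 + pointNum e y) :=
      hr _ (by simp; omega) (by omega)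
    have hf4 : m.nat 6 + pointNum e y ≠ 4 := by omega
    refine Prog.Ends.mono (Prog.Ends.seq (Prog.ends_block (k := 3)
      (Q := fun m'' => m'' = (m'.setReal 4 (dist x y)).setNat 10 (16 + pointNum e y))
      hB _ (by decide) (by simp [h2, h7, h8]))
      (T' := 6 * timeUnit n B 0) ?_) (by omega) fun _ h => h
    rintro _ rfl
    refine Prog.Ends.mono (Prog.Ends.ite
      (fun hlt => Prog.ends_block (k := 5) hB _ (by decide) ?_)
      (fun hlt => Prog.ends_block (k := 5) hB _ (by decide) ?_)) (by omega) fun _ h => h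
    all_goals
      simp only [Test.Holds, Memory.setReal_real, Memory.setNat_real, Nat.reduceEqDiff, if_false,
        if_true, h3] at hlt
      refine ⟨fun z hz => ?_, fun a ha ha' => ?_⟩
      · have hz4 : 16 + pointNum e z ≠ 4 := by omega
        have hz9 : 16 + pointNum e z ≠ 9 := by omega
        rw [Nat.lt_succ_iff_lt_or_eq, pointNum_inj] at hz
        by_cases hzy : z = y
        · subst hzy; simp [hlt, h8, h1, h3, h6', hf, hf4]
        · simp [hzy, h8, hz4, hz9, hI z (hz.resolve_right hzy)]
      · have h4 : a ≠ 4 ∧ a ≠ 9 := by simpa using ha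
        have : a ≠ 16 + pointNum e y := by omega
        simp [h4.1, h4.2, this, hr a ha ha']
  · rintro m' ⟨⟨h, hr⟩, hn⟩
    exact ⟨fun x => h x (pointNum_lt e x), hn, hr⟩

/-- The registers that follow the level of `i` hold what `nextLevel` says. -/
def HasLevel (i : ℕ) (m : Memory) : Prop :=
  ∃ k, m.nat 13 = 2 ^ k ∧ m.nat 14 = k ∧ i < 2 ^ k ∧ k ≤ m.nat 15 ∧ m.nat 15 = 4 ^ level i ∧
    m.real 6 = m.real 3 * 2 ^ level i

omit [MetricSpace X] in
lemma nextLevel_ends {D : Fin n → Fin n → ℝ} (hB : ∀ i j, τ i j ≤ B) (hm : HasConstants n m)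
    {i : ℕ} (hi : m.nat 11 = i) (h : HasLevel i m) :
    nextLevel.Ends D τ m (15 * timeUnit n B 0) fun m' =>
      HasLevel (i + 1) m' ∧ (∀ a ∉ [10, 13, 14, 15], m'.nat a = m.nat a) ∧
        ∀ a ∉ [6], m'.real a = m.real a := by
  have ht1 := one_le_timeUnit n B 0
  suffices h' : nextLevel.Ends D τ m (15 * timeUnit n B 0) (HasLevel (i + 1)) from
    ((h'.frame_nat _ (by decide)).frame_real _ (by decide)).imp fun _ h => ⟨h.1.1, h.1.2, h.2⟩
  obtain ⟨k, h13, h14, hik, hk, h15, h6⟩ := h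
  have h1 := hm.one
  refine Prog.Ends.mono (Prog.Ends.seq (Prog.ends_block (k := 2)
    (Q := fun m' => m' = m.setNat 10 (i + 1)) hB _ (by decide) (by simp [hi, h1]))
    (T' := 11 * timeUnit n B 0) ?_) (by omega) fun _ h => h
  rintro _ rfl
  refine Prog.Ends.mono (Prog.Ends.ite (T := 10 * timeUnit n B 0)
    (fun hlt => Prog.Ends.mono (Prog.ends_skip ?_) (by omega) fun _ h => h)
    (fun hlt => ?_)) (by omega) fun _ h => h
  · simp [h13] at hlt
    have hlev : level (i + 1) = level i := by
      rw [level, if_pos]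
      exact hlt.trans_le (Nat.pow_le_pow_right (by norm_num) (h15 ▸ hk))
    exact ⟨k, by simp [h13], by simp [h14], hlt, by simpa using hk, by simp [h15, hlev],
      by simp [h6, hlev]⟩
  simp [h13] at hlt
  have hik' : i + 1 = 2 ^ k := by omega
  refine Prog.Ends.mono (Prog.Ends.seq (Prog.ends_block (k := 2)
    (Q := fun m' => m' = (m.setNat 10 (i + 1)).setNat 13 (2 ^ (k + 1))) hB _ (by decide)
    (by simp [h13, pow_succ, mul_two])) (T' := 6 * timeUnit n B 0) ?_) (by omega) fun _ h => h
  rintro _ rfl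
  refine Prog.Ends.mono (Prog.Ends.ite
      (fun hlt => Prog.ends_block (k := 5) hB _ (by decide) ?_)
      (fun hlt => Prog.ends_block (k := 5) hB _ (by decide) ?_)) (by omega) fun _ h => h
  · simp [h14] at hlt
    have hlev : level (i + 1) = level i := by
      rw [level, if_pos]
      rw [hik']
      exact Nat.pow_lt_pow_right (by norm_num) (h15 ▸ hlt)
    refine ⟨k + 1, by simp, by simp [h14, h1], ?_, by simpa using hlt, by simp [h15, hlev],
      by simp [h6, hlev]⟩
    rw [hik', pow_succ]; omega
  · simp [h14] at hlt
    have hk4 : k = 4 ^ level i := by omega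
    have hlev : level (i + 1) = level i + 1 := by
      rw [level, if_neg]
      rw [hik', ← hk4]; omega
    refine ⟨k + 1, by simp, by simp [h14, h1], ?_, ?_, ?_, ?_⟩
    · rw [hik', pow_succ]; omega
    · have := Nat.one_le_pow (level i) 4 (by norm_num)
      simp [h15]; omega
    · simp [hlev, h15, pow_succ]; omega
    · simp [hlev, h6, pow_succ]; ring

lemma HasLevel.of_eq {i : ℕ} {m m' : Memory} (h : HasLevel i m) (h13 : m'.nat 13 = m.nat 13)
    (h14 : m'.nat 14 = m.nat 14) (h15 : m'.nat 15 = m.nat 15) (h3 : m'.real 3 = m.real 3)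
    (h6 : m'.real 6 = m.real 6) : HasLevel i m' := by
  rw [HasLevel, h13, h14, h15, h3, h6]
  exact h

lemma greedyRound_ends (hB : ∀ i j, τ i j ≤ B) (hm : HasConstants n m)
    (hW : ∀ x, m.real (16 + pointNum e x) = W x) {i : ℕ} (hlev : HasLevel i m)
    (h3 : 0 ≤ m.real 3) (h5 : m.real 5 = m.real 3 / 32) {f : X → ℝ} {x : X}
    (hg : IsGreedy (m.real 3) f x i W (m.real 8)) :
    greedyRound.Ends (fun i j => dist (e i) (e j)) τ m (40 * timeUnit n B 1) fun m' =>
      (∃ W' : X → ℝ, (∀ x, m'.real (16 + pointNum e x) = W' x) ∧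
        IsGreedy (m.real 3) f x (i + 1) W' (m'.real 8)) ∧
      (∀ a ∉ [8, 10, 12], m'.nat a = m.nat a) ∧ AgreeOff n [4, 7, 8, 9] m m' := by
  have ht1 := one_le_timeUnit n B 0
  have ht : timeUnit n B 0 ≤ timeUnit n B 1 := timeUnit_le_succ n B 0
  have h6 : m.real 6 = m.real 3 * 2 ^ level i := hlev.choose_spec.2.2.2.2.2
  refine Prog.Ends.mono (Prog.Ends.seq (findBest_ends hB hm hW) (T' := 24 * timeUnit n B 1) ?_)
    (by omega) fun _ h => h
  rintro m₁ ⟨⟨hbest, hmax, hu⟩, hn, hr⟩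
  have hm₁ : HasConstants n m₁ := hm.of_eq hn (hr 1 (by decide)) (by decide)
  have hW₁ : ∀ z, m₁.real (16 + pointNum e z) = W z := fun z =>
    (hr _ (by simp; omega)).trans (hW z)
  have h8 := hr 8 (by decide)
  have hr₁ : AgreeOff n [4, 7, 8, 9] m m₁ := fun a ha _ => hr a (by simp at ha ⊢; tauto)
  refine Prog.Ends.mono (Prog.Ends.ite (T := 23 * timeUnit n B 1) (fun hlt => ?_)
    (fun hlt => Prog.Ends.mono (Prog.ends_skip ?_) (by omega) fun _ h => h)) (by omega)
    fun _ h => h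
  · rw [Test.Holds, hm₁.realZero] at hlt
    obtain ⟨u, hu12, hu⟩ := hu hlt
    have h6₁ := hr 6 (by decide)
    refine Prog.Ends.mono (Prog.Ends.seq (Prog.ends_block (k := 2)
      (Q := fun m' => m' = m₁.setReal 9 (W u + m.real 3 * 2 ^ level i)) hB _ (by decide)
      (by simp [hu, h6₁, h6])) (T' := 20 * timeUnit n B 1) ?_) (by omega) fun _ h => h
    rintro _ rfl
    refine Prog.Ends.mono (Prog.Ends.seq (T := 5 * timeUnit n B 0)
      (Q := fun m' => m'.real 8 = max (m.real 8) (W u + m.real 3 * 2 ^ level i) ∧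
        m'.nat = m₁.nat ∧ ∀ a ∉ [8, 9], m'.real a = m₁.real a) ?_
      (T' := 12 * timeUnit n B 1) ?_) (by omega) fun _ h => h
    · refine Prog.Ends.mono (Prog.Ends.ite
        (fun hlt => Prog.ends_block (k := 2) hB _ (by decide) ?_)
        (fun hlt => Prog.Ends.mono (Prog.ends_skip ?_) (by omega) fun _ h => h)) (by omega)
        fun _ h => h
      · simp [h8] at hlt
        refine ⟨by simp [hm₁.realZero, max_eq_right hlt.le], by simp, fun a ha => ?_⟩
        have ha' : a ≠ 8 ∧ a ≠ 9 := by simpa using ha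
        simp [ha'.1, ha'.2]
      · simp [h8] at hlt
        refine ⟨by simp [h8, hlt], by simp, fun a ha => ?_⟩
        have ha' : a ≠ 8 ∧ a ≠ 9 := by simpa using ha
        simp [ha'.2]
    · rintro m₂ ⟨h8₂, hn₂, hr₂⟩
      have hm₂ : HasConstants n m₂ :=
        hm₁.of_eq (S := []) (fun a _ => by rw [hn₂]) (hr₂ 1 (by decide)) (by decide)
      refine (removeBall_ends (e := e) hB hm₂ (u := u) (by rw [hn₂, hu12])
        (fun z => (hr₂ _ (by simp; omega)).trans (hW₁ z))).imp ?_
      rintro m₃ ⟨hW₃, hn₃, hr₃⟩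
      refine ⟨⟨_, hW₃, ?_⟩, fun a ha => ?_, ?_⟩
      · rw [hr₃ 8 (by decide) (by omega), h8₂, hr₂ 5 (by decide), hr 5 (by decide), h5]
        exact hg.pick h3 (hu ▸ hlt) fun z => hu ▸ hmax z
      · rw [hn₃ a (by simp at ha ⊢; tauto), hn₂, hn a ha]
      · exact hr₁.trans (AgreeOff.trans (S := [8, 9]) (S'' := [4, 7, 8, 9])
          (fun a ha _ => hr₂ a ha) hr₃ (by simp) (by simp)) (by simp) (by simp)
  · rw [Test.Holds, hm₁.realZero, not_lt] at hlt
    exact ⟨⟨W, hW₁, h8 ▸ hg.idle fun z => (hmax z).trans hlt⟩, hn, hr₁⟩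

lemma tableEntry_ends [Fintype X] (hB : ∀ i j, τ i j ≤ B) (hm : HasConstants n m) {x : X}
    (hx : m.nat 7 = pointNum e x) (h6n : 16 + n ≤ m.nat 6)
    (h3 : 0 ≤ m.real 3) (h5 : m.real 5 = m.real 3 / 32) {f : X → ℝ} (hf : ∀ z, 0 ≤ f z)
    (hmf : ∀ z, m.real (m.nat 6 + pointNum e z) = f z) :
    tableEntry.Ends (fun i j => dist (e i) (e j)) τ m (100 * timeUnit n B 2) fun m' =>
      IsEntry (m.real 3) f x (m'.real (m.nat 5 + 1 + pointNum e x)) ∧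
      (∀ a ∉ [8, 9, 10, 11, 12, 13, 14, 15], m'.nat a = m.nat a) ∧
      ∀ a ∉ [4, 6, 7, 8, 9], a ≠ m.nat 5 + 1 + pointNum e x → a < 16 ∨ 16 + n ≤ a →
        m'.real a = m.real a := by
  have hcard : Fintype.card X = n := by rw [← Fintype.card_congr e, Fintype.card_fin]
  have ht0 := one_le_timeUnit n B 0
  have ht1 : timeUnit n B 0 ≤ timeUnit n B 1 := timeUnit_le_succ n B 0
  have ht2 : timeUnit n B 1 ≤ timeUnit n B 2 := timeUnit_le_succ n B 1
  refine Prog.Ends.mono (Prog.Ends.seq (initWeights_ends hB hm hx h6n)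
    (T' := 75 * timeUnit n B 2) ?_) (by omega) fun _ h => h
  rintro m₁ ⟨hW₁, hn₁, hr₁⟩
  simp only [hmf] at hW₁
  have hm₁ : HasConstants n m₁ := hm.of_eq hn₁ (hr₁ 1 (by decide) (by omega)) (by decide)
  refine Prog.Ends.mono (Prog.Ends.seq (Prog.ends_block (k := 6) (Q := fun m' =>
    m' = ((((m₁.setReal 8 0).setReal 6 (m.real 3)).setNat 13 1).setNat 14 0).setNat 15 1)
    hB _ (by decide)
    (by simp [hm₁.realZero, hr₁ 3 (by decide) (by omega)]))
    (T' := 67 * timeUnit n B 2) ?_) (by omega) fun _ h => h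
  rintro m₂ hm₂
  have hr₂ : ∀ a ∉ [6, 8], m₂.real a = m₁.real a := fun a ha => by
    have ha' : a ≠ 6 ∧ a ≠ 8 := by simpa using ha
    simp [hm₂, ha'.1, ha'.2]
  have hn₂ : ∀ a ∉ [13, 14, 15], m₂.nat a = m₁.nat a := fun a ha => by
    have ha' : a ≠ 13 ∧ a ≠ 14 ∧ a ≠ 15 := by simpa using ha
    simp [hm₂, ha'.1, ha'.2]
  have h3₂ : m₂.real 3 = m.real 3 :=
    (hr₂ 3 (by decide)).trans (hr₁ 3 (by decide) (by omega))
  have h5₂ : m₂.real 5 = m.real 5 :=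
    (hr₂ 5 (by decide)).trans (hr₁ 5 (by decide) (by omega))
  have hc₂ : HasConstants n m₂ := hm₁.of_eq hn₂ (hr₂ 1 (by decide)) (by decide)
  have hl₂ : HasLevel 0 m₂ := by
    refine ⟨0, ?_⟩
    rw [h3₂]
    simp [hm₂, level]
  have h8₂ : m₂.real 8 = 0 := by simp [hm₂]
  have hW₂ : ∀ z, m₂.real (16 + pointNum e z) = m₁.real (16 + pointNum e z) := fun z =>
    hr₂ _ (by simp; omega)
  have hr12 : AgreeOff n [4, 6, 7, 8, 9] m m₂ :=
    hr₁.trans (S' := [6, 8]) (fun a ha _ => hr₂ a ha) (by simp) (by simp)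
  clear hm₂
  refine Prog.Ends.mono (Prog.Ends.seq (Prog.Ends.forBelow (m := m₂) hB (c := 60) (d := 1)
    [8, 10, 12, 13, 14, 15] (by decide) (by decide) hc₂.size hc₂.one
    (fun i m' => (∃ W : X → ℝ, (∀ z, m'.real (16 + pointNum e z) = W z) ∧
      IsGreedy (m.real 3) f x i W (m'.real 8)) ∧ HasLevel i m' ∧
      AgreeOff n [4, 6, 7, 8, 9] m₂ m') ?_ ?_) (T' := 5 * timeUnit n B 0) ?_)
    (by simp only [Nat.reduceAdd]; omega) fun _ h => h
  · refine ⟨⟨_, hW₂, ?_⟩, hl₂.of_eq (by simp) (by simp) (by simp) rfl rfl, fun _ _ _ => rfl⟩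
    simp only [Memory.setNat_real, h8₂]
    exact isGreedy_zero hW₁
  · rintro i hi m₃ hn₃ h11 ⟨⟨W, hW, hg⟩, hl, hr₃⟩
    have hm₃ : HasConstants n m₃ := hc₂.of_eq hn₃ (hr₃ 1 (by decide) (by omega)) (by decide)
    have h3₃ : m₃.real 3 = m.real 3 := (hr₃ 3 (by decide) (by omega)).trans h3₂
    have h5₃ : m₃.real 5 = m.real 5 := (hr₃ 5 (by decide) (by omega)).trans h5₂
    rw [← h3₃] at hg
    refine Prog.Ends.mono (Prog.Ends.seq
      (greedyRound_ends hB hm₃ hW hl (h3₃ ▸ h3) (by rw [h5₃, h3₃, h5]) hg)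
      (T' := 15 * timeUnit n B 0) ?_) (by omega) fun _ h => h
    rintro m₄ ⟨⟨W', hW', hg'⟩, hn₄, hr₄⟩
    have hm₄ : HasConstants n m₄ := hm₃.of_eq hn₄ (hr₄ 1 (by decide) (by omega)) (by decide)
    refine (nextLevel_ends hB hm₄ ((hn₄ 11 (by decide)).trans h11)
      (hl.of_eq (hn₄ 13 (by decide)) (hn₄ 14 (by decide)) (hn₄ 15 (by decide))
        (hr₄ 3 (by decide) (by omega)) (hr₄ 6 (by decide) (by omega)))).imp ?_
    rintro m₅ ⟨hl₅, hn₅, hr₅⟩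
    refine ⟨⟨W', fun z => ?_, ?_⟩, hl₅.of_eq (by simp) (by simp) (by simp) rfl rfl, ?_⟩
    · exact (hr₅ _ (by simp; omega)).trans (hW' z)
    · simp only [Memory.setNat_real]
      rw [hr₅ 8 (by decide), ← h3₃]
      exact hg'
    · exact hr₃.trans (hr₄.trans (S' := [6]) (S'' := [4, 6, 7, 8, 9]) (fun a ha _ => hr₅ a ha)
        (by simp) (by simp)) (by simp) (by simp)
  · rintro m₃ ⟨⟨⟨W, hW, hg⟩, -, hr₃⟩, hn₃⟩
    have h1 : m₃.nat 1 = 1 := (hn₃ 1 (by decide)).trans hc₂.one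
    have h7 : m₃.nat 7 = pointNum e x := (hn₃ 7 (by decide)).trans
      ((hn₂ 7 (by decide)).trans ((hn₁ 7 (by decide)).trans hx))
    have h5' : m₃.nat 5 = m.nat 5 := (hn₃ 5 (by decide)).trans
      ((hn₂ 5 (by decide)).trans (hn₁ 5 (by decide)))
    refine Prog.Ends.mono (Prog.ends_block (k := 5) (Q := fun m' =>
      m' = (m₃.setNat 10 (m.nat 5 + 1 + pointNum e x)).setReal (m.nat 5 + 1 + pointNum e x)
        (m₃.real 8)) hB _ (by decide) ?_) le_rfl ?_
    · simp only [List.foldl_cons, List.foldl_nil, effect_natAdd, effect_realStore,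
        Memory.setNat_nat, Memory.setNat_real, if_true, h1, h7, h5', Nat.reduceEqDiff, if_false]
      congr 1
      simp only [Memory.setNat, Function.update_idem]
    · rintro _ rfl
      refine ⟨?_, fun a ha => ?_, fun a ha hax ha' => ?_⟩
      · simp only [Memory.setReal_real, if_true]
        rw [← hcard] at hg
        exact hg.isEntry h3 hf
      · have ha' : a ≠ 10 := by rintro rfl; simp at ha
        simp only [Memory.setReal_nat, Memory.setNat_nat, if_neg ha']
        rw [hn₃ a (by simp at ha ⊢; tauto), hn₂ a (by simp at ha ⊢; tauto),
          hn₁ a (by simp at ha ⊢; tauto)]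
      · simp only [Memory.setReal_real, if_neg hax, Memory.setNat_real]
        exact (hr₃ a ha ha').trans (hr12 a ha ha')

end Entry

/-! ### The program for the table -/

/-- The start of the `j`-th row of the table. The register contains the `j`-th scale; it is
followed by one entry for each point. -/
def rowStart (n j : ℕ) : ℕ := 16 + n + j * (n + 1)

lemma rowStart_succ (n j : ℕ) : rowStart n (j + 1) = rowStart n j + (n + 1) := by
  rw [rowStart, rowStart]; ring

lemma rowStart_lt {n i j : ℕ} (h : i < j) : rowStart n i + n < rowStart n j := by
  have : (i + 1) * (n + 1) ≤ j * (n + 1) := Nat.mul_le_mul_right _ h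
  rw [add_mul] at this
  rw [rowStart, rowStart]
  omega

lemma le_rowStart (n j : ℕ) : 16 + n ≤ rowStart n j := Nat.le_add_right _ _

/-- Go one row down and compute its entries. -/
def tableRow : Prog :=
  .seq (.block [.natSub 5 5 3, .natAdd 6 5 3, .natAdd 6 6 3, .natAdd 6 6 1, .realLoad 3 5,
      .realHalf 5 3, .realHalf 5 5, .realHalf 5 5, .realHalf 5 5, .realHalf 5 5])
    (.forBelow 7 tableEntry)

/-- Set `R[3]` to the largest distance that is at most `R[2]`. -/
def largestDist : Prog :=
  .seq (.block [.realZero 3])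
    (.forBelow 8 (.forBelow 9 (.seq (.block [.query 4 8 9])
      (.ite (.realLt 2 4) .skip (.ite (.realLt 3 4) (.block [.realAdd 3 4 1]) .skip)))))

/-- Store the next scale, go one row up, and divide the scale by `16`. -/
def nextScale : Prog :=
  .seq largestDist (.block [.realStore 5 3, .natAdd 5 5 3, .realHalf 2 3, .realHalf 2 2,
    .realHalf 2 2, .realHalf 2 2])

/-- Set up the constants, and let `R[2]` be an upper bound for the distances. -/
def setUp : Prog :=
  .seq (.block [.natConst 1 1, .natConst 2 16, .natAdd 3 0 1, .natAdd 4 2 0, .natAdd 5 2 0])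
    (.seq (.forBelow 8 (.block [.query 4 9 8, .realAdd 2 2 4])) (.block [.realAdd 2 2 2]))

/-- Set `R[0]` to the maximum over the points of the sum of the entries in the lowest two rows. -/
def readResult : Prog :=
  .forBelow 7 (.seq (.block [.natAdd 10 4 1, .natAdd 10 10 7, .realLoad 9 10, .natAdd 10 10 3,
      .realLoad 4 10, .realAdd 9 9 4])
    (.ite (.realLt 0 9) (.block [.realAdd 0 9 1]) .skip))

/-- The program that approximates `γ₂`. -/
def gammaTwoProg : Prog :=
  .seq setUp (.seq (.while (.realLt 1 2) nextScale)
    (.seq (.while (.natLt 4 5) tableRow) readResult))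

section Table

variable {n : ℕ} {X : Type*} [MetricSpace X] (e : Fin n ≃ X) {τ : Fin n → Fin n → ℕ} {B : ℕ}
  {m m' : Memory}

/-- The `j`-th scale in the memory. -/
def Memory.scale (n : ℕ) (m : Memory) (j : ℕ) : ℝ := m.real (rowStart n j)

/-- The entry for `x` in the `j`-th row of the table in the memory. -/
def Memory.entry (m : Memory) (j : ℕ) (x : X) : ℝ := m.real (rowStart n j + 1 + pointNum e x)

variable {e}

lemma tableRow_ends [Fintype X] (hB : ∀ i j, τ i j ≤ B) (hm : HasConstants n m) {j : ℕ}
    (h5 : m.nat 5 = rowStart n (j + 1)) (hs : 0 ≤ m.scale n j)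
    (hf : ∀ z, 0 ≤ m.entry e (j + 2) z) :
    tableRow.Ends (fun i j => dist (e i) (e j)) τ m (113 * timeUnit n B 3) fun m' =>
      (∀ x, IsEntry (m.scale n j) (m.entry e (j + 2)) x (m'.entry e j x)) ∧
      m'.nat 5 = rowStart n j ∧ HasConstants n m' ∧
      ∀ a ∉ [3, 4, 5, 6, 7, 8, 9], (∀ x, a ≠ rowStart n j + 1 + pointNum e x) →
        a < 16 ∨ 16 + n ≤ a → m'.real a = m.real a := by
  have ht0 := one_le_timeUnit n B 0
  have ht1 : timeUnit n B 0 ≤ timeUnit n B 1 := timeUnit_le_succ n B 0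
  have ht2 : timeUnit n B 1 ≤ timeUnit n B 2 := timeUnit_le_succ n B 1
  have ht3 : timeUnit n B 2 ≤ timeUnit n B 3 := timeUnit_le_succ n B 2
  have hj := le_rowStart n j
  refine Prog.Ends.mono (Prog.Ends.seq (Prog.ends_block (k := 11) (Q := fun m' =>
      m'.nat 5 = rowStart n j ∧ m'.nat 6 = rowStart n (j + 2) + 1 ∧ m'.real 3 = m.scale n j ∧
      m'.real 5 = m.scale n j / 32 ∧ (∀ a ∉ [5, 6], m'.nat a = m.nat a) ∧
      ∀ a ∉ [3, 5], m'.real a = m.real a) hB _ (by decide) ?_)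
    (T' := 101 * timeUnit n B 3) ?_) (by omega) fun _ h => h
  · have h5' : rowStart n (j + 1) - (n + 1) = rowStart n j := by rw [rowStart_succ]; omega
    refine ⟨by simp [h5, hm.stride, h5'], ?_, ?_, ?_, fun a ha => ?_, fun a ha => ?_⟩
    · simp [h5, hm.stride, hm.one, rowStart_succ]
    · simp [h5, hm.stride, h5', Memory.scale]
    · simp [h5, hm.stride, h5', Memory.scale]; ring
    · have ha' : a ≠ 5 ∧ a ≠ 6 := by simpa using ha
      simp [ha'.1, ha'.2]
    · have ha' : a ≠ 3 ∧ a ≠ 5 := by simpa using ha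
      simp [ha'.1, ha'.2]
  rintro m₁ ⟨h5₁, h6₁, h3₁, h5r, hn₁, hr₁⟩
  have hm₁ : HasConstants n m₁ := hm.of_eq hn₁ (hr₁ 1 (by decide)) (by decide)
  have hj2 : rowStart n j + n < rowStart n (j + 2) := rowStart_lt (by omega)
  refine Prog.Ends.mono (Prog.Ends.forBelow (m := m₁) hB (c := 100) (d := 2)
    [8, 9, 10, 11, 12, 13, 14, 15] (by decide) (by decide) hm₁.size hm₁.one
    (fun k m' => (∀ x, pointNum e x < k →
        IsEntry (m.scale n j) (m.entry e (j + 2)) x (m'.entry e j x)) ∧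
      ∀ a ∉ [4, 6, 7, 8, 9], (∀ x, a ≠ rowStart n j + 1 + pointNum e x) →
        a < 16 ∨ 16 + n ≤ a → m'.real a = m₁.real a) (by simp) ?_) le_rfl ?_
  · rintro k hk m₂ hn₂ h7 ⟨hI, hr₂⟩
    obtain ⟨x, rfl⟩ := exists_pointNum e hk
    have hlow : ∀ a < 16, ∀ x, a ≠ rowStart n j + 1 + pointNum e x := fun a ha x => by omega
    have h3₂ : m₂.real 3 = m.scale n j :=
      (hr₂ 3 (by decide) (hlow 3 (by omega)) (by omega)).trans h3₁
    have h5₂ : m₂.real 5 = m.scale n j / 32 :=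
      (hr₂ 5 (by decide) (hlow 5 (by omega)) (by omega)).trans h5r
    have hn5 : m₂.nat 5 = rowStart n j := (hn₂ 5 (by decide)).trans h5₁
    have hn6 : m₂.nat 6 = rowStart n (j + 2) + 1 := (hn₂ 6 (by decide)).trans h6₁
    have hm₂ : HasConstants n m₂ :=
      hm₁.of_eq hn₂ (hr₂ 1 (by decide) (hlow 1 (by omega)) (by omega)) (by decide)
    refine (tableEntry_ends hB hm₂ h7 (by omega) (h3₂ ▸ hs) (by rw [h5₂, h3₂])
      (f := m.entry e (j + 2)) hf fun z => ?_).imp ?_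
    · rw [hn6, hr₂ _ (by simp; omega) (fun x => by have := pointNum_lt e x; omega) (by omega),
        hr₁ _ (by simp; omega)]
      rfl
    · rintro m₃ ⟨hE, hn₃, hr₃⟩
      rw [hn5] at hE hr₃
      rw [h3₂] at hE
      refine ⟨fun y hy => ?_, fun a ha hax ha' => ?_⟩
      · by_cases hyx : y = x
        · subst hyx; exact hE
        · have hne : pointNum e y ≠ pointNum e x := mt (pointNum_inj e).1 hyx
          have h := hI y (by omega)
          rw [Memory.entry] at h ⊢
          simp only [Memory.setNat_real]
          rw [hr₃ _ (by simp; omega) (by omega) (by omega)]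
          exact h
      · exact (hr₃ a ha (hax x) ha').trans (hr₂ a ha hax ha')
  · rintro m₂ ⟨⟨hI, hr₂⟩, hn₂⟩
    refine ⟨fun x => hI x (pointNum_lt e x), (hn₂ 5 (by decide)).trans h5₁,
      hm₁.of_eq hn₂ (hr₂ 1 (by decide) (fun x => by omega) (by omega)) (by decide),
      fun a ha hax ha' => ?_⟩
    rw [hr₂ a (by simp at ha ⊢; tauto) hax ha', hr₁ a (by simp at ha ⊢; tauto)]

/-- The rows of the table from the `j`-th one on have been computed. -/
def IsTable (e : Fin n ≃ X) (r : ℕ → ℝ) (j : ℕ) (m : Memory) : Prop :=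
  ∀ i, j ≤ i → ∀ x, IsEntry (r i) (m.entry e (i + 2)) x (m.entry e i x)

lemma tableRows_ends [Fintype X] (hB : ∀ i j, τ i j ≤ B) {r : ℕ → ℝ} (hr : ∀ i, 0 ≤ r i)
    (hm : HasConstants n m) {M : ℕ} (h5 : m.nat 5 = rowStart n M) (hs : ∀ i, m.scale n i = r i)
    (ht : IsTable e r M m) (h0 : m.real 0 = 0) :
    (Prog.while (.natLt 4 5) tableRow).Ends (fun i j => dist (e i) (e j)) τ m
      (rowStart n M * (113 * timeUnit n B 3 + 1) + 1) fun m' =>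
        HasConstants n m' ∧ IsTable e r 0 m' ∧ m'.real 0 = 0 ∧
        ∀ i, M ≤ i → ∀ x, m'.entry e i x = m.entry e i x := by
  refine Prog.Ends.mono (Prog.Ends.while (m := m) (T := 113 * timeUnit n B 3)
    (fun m' => HasConstants n m' ∧ (∀ i, m'.scale n i = r i) ∧ m'.real 0 = 0 ∧
      (∀ i, M ≤ i → ∀ x, m'.entry e i x = m.entry e i x) ∧
      ∃ j ≤ M, m'.nat 5 = rowStart n j ∧ IsTable e r j m')
    (fun m' => m'.nat 5) ?_ ⟨hm, hs, h0, fun _ _ _ => rfl, M, le_rfl, h5, ht⟩) (by rw [h5]) ?_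
  · rintro m₁ ⟨hm₁, hs₁, h0₁, hM, j, hjM, h5₁, ht₁⟩ hb
    rw [Test.Holds, hm₁.rows, h5₁] at hb
    obtain ⟨j, rfl⟩ : ∃ i, j = i + 1 := by
      rcases j with _ | j
      · simp [rowStart] at hb
      · exact ⟨j, rfl⟩
    refine (tableRow_ends hB hm₁ h5₁ (hs₁ j ▸ hr j)
      (fun z => (ht₁ (j + 2) (by omega) z).nonneg)).imp ?_
    rintro m₂ ⟨hE, h5₂, hm₂, hr₂⟩
    have hj := le_rowStart n j
    have hent : ∀ i, j < i → ∀ x, m₂.entry e i x = m₁.entry e i x := fun i hi x => by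
      have h := rowStart_lt (n := n) hi
      exact hr₂ _ (by simp; omega) (fun y => by have := pointNum_lt e y; omega) (by omega)
    refine ⟨⟨hm₂, fun i => ?_, ?_, fun i hi x => ?_, j, by omega, h5₂, fun i hi x => ?_⟩, ?_⟩
    · rw [← hs₁ i]
      have := le_rowStart n i
      refine hr₂ _ (by simp; omega) (fun y => ?_) (by omega)
      have := pointNum_lt e y
      rcases lt_trichotomy i j with h | rfl | h
      · have := rowStart_lt (n := n) h
        omega
      · omega
      · have := rowStart_lt (n := n) h
        omega
    · rw [hr₂ 0 (by decide) (fun x => by omega) (by omega), h0₁]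
    · rw [hent i (by omega), hM i hi]
    · have h2 : m₂.entry e (i + 2) = m₁.entry e (i + 2) := funext (hent (i + 2) (by omega))
      rcases hi.eq_or_lt with rfl | hi
      · rw [h2, ← hs₁]; exact hE x
      · rw [h2, hent i hi]; exact ht₁ i hi x
    · rw [h5₂, h5₁]
      have := rowStart_lt (n := n) (Nat.lt_succ_self j)
      simp only [Nat.succ_eq_add_one] at this
      omega
  · rintro m₁ ⟨⟨hm₁, hs₁, h0₁, hM, j, hjM, h5₁, ht₁⟩, hb⟩
    rw [Test.Holds, hm₁.rows, h5₁, not_lt] at hb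
    refine ⟨hm₁, ?_, h0₁, hM⟩
    rcases j with _ | j
    · exact ht₁
    · rw [rowStart_succ] at hb
      have := le_rowStart n j
      omega

/-! ### The program for the scales -/

/-- `s` is the largest distance that is at most `b`. -/
structure IsLargestDist (X : Type*) [MetricSpace X] (b s : ℝ) : Prop where
  nonneg : 0 ≤ s
  attained : s = 0 ∨ ∃ x y : X, s = dist x y ∧ s ≤ b
  dist_le : ∀ x y : X, dist x y ≤ b → dist x y ≤ s

lemma largestDist_ends (hB : ∀ i j, τ i j ≤ B) (hm : HasConstants n m) :
    largestDist.Ends (fun i j => dist (e i) (e j)) τ m (16 * timeUnit n B 2) fun m' =>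
      IsLargestDist X (m.real 2) (m'.real 3) ∧ (∀ a ∉ [8, 9], m'.nat a = m.nat a) ∧
        ∀ a ∉ [3, 4], m'.real a = m.real a := by
  have ht0 := one_le_timeUnit n B 0
  have ht1 : timeUnit n B 0 ≤ timeUnit n B 1 := timeUnit_le_succ n B 0
  have ht2 : timeUnit n B 1 ≤ timeUnit n B 2 := timeUnit_le_succ n B 1
  suffices h : largestDist.Ends (fun i j => dist (e i) (e j)) τ m (16 * timeUnit n B 2) fun m' =>
      IsLargestDist X (m.real 2) (m'.real 3) from
    ((h.frame_nat _ (by decide)).frame_real _ (by decide)).imp fun _ h => ⟨h.1.1, h.1.2, h.2⟩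
  refine Prog.Ends.mono (Prog.Ends.seq (Prog.ends_block (k := 2)
    (Q := fun m' => m' = m.setReal 3 0) hB _ (by decide) rfl)
    (T' := 13 * timeUnit n B 2) ?_) (by omega) fun _ h => h
  rintro _ rfl
  let I : (X → X → Prop) → Memory → Prop := fun S m' => 0 ≤ m'.real 3 ∧
    (m'.real 3 = 0 ∨ ∃ x y : X, m'.real 3 = dist x y ∧ m'.real 3 ≤ m.real 2) ∧
    ∀ x y, S x y → dist x y ≤ m.real 2 → dist x y ≤ m'.real 3
  refine Prog.Ends.mono (Prog.Ends.forBelow_real (m := m.setReal 3 0) hB (c := 12) (d := 1)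
    [9] [3, 4] (by decide) (by decide) (by decide) hm.size hm.one
    (fun k => I fun x _ => pointNum e x < k) (by simp [I]) ?_) (by simp only [Nat.reduceAdd]; omega)
    ?_
  · intro k hk m₁ hn₁ hr₁ h8 hI
    obtain ⟨x, rfl⟩ := exists_pointNum e hk
    have h0 : m₁.nat 0 = n := (hn₁ 0 (by decide)).trans hm.size
    have h1 : m₁.nat 1 = 1 := (hn₁ 1 (by decide)).trans hm.one
    refine Prog.Ends.mono (Prog.Ends.forBelow_real (m := m₁) hB (c := 10) (d := 0)
      [] [3, 4] (by decide) (by decide) (by decide) h0 h1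
      (fun k => I fun x' y => pointNum e x' < pointNum e x ∨ x' = x ∧ pointNum e y < k)
      (by simpa [I] using hI) ?_) (by simp only [zero_add]; omega) ?_
    · intro k hk m₂ hn₂ hr₂ h9 hI
      obtain ⟨y, rfl⟩ := exists_pointNum e hk
      have h8₂ : m₂.nat 8 = pointNum e x := (hn₂ 8 (by decide)).trans h8
      have h2 : m₂.real 2 = m.real 2 := (hr₂ 2 (by decide)).trans (hr₁ 2 (by decide))
      have h1₂ : m₂.real 1 = 0 :=
        (hr₂ 1 (by decide)).trans ((hr₁ 1 (by decide)).trans hm.realZero)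
      obtain ⟨hI1, hI2, hI3⟩ := hI
      have hcase : ∀ x' y', (pointNum e x' < pointNum e x ∨
          x' = x ∧ pointNum e y' < pointNum e y + 1) →
          (pointNum e x' < pointNum e x ∨ x' = x ∧ pointNum e y' < pointNum e y) ∨
          x' = x ∧ y' = y := fun x' y' h => by
        rcases h with h | ⟨h, h'⟩
        · exact Or.inl (Or.inl h)
        · rcases Nat.lt_succ_iff_lt_or_eq.1 h' with h' | h'
          · exact Or.inl (Or.inr ⟨h, h'⟩)
          · exact Or.inr ⟨h, (pointNum_inj e).1 h'⟩
      refine Prog.Ends.mono (Prog.Ends.seq (Prog.ends_block (k := 2)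
        (Q := fun m' => m' = m₂.setReal 4 (dist x y)) hB _ (by decide) (by simp [h8₂, h9]))
        (T' := 5 * timeUnit n B 0) ?_) (by omega) fun _ h => h
      rintro _ rfl
      refine Prog.Ends.mono (Prog.Ends.ite (T := 4 * timeUnit n B 0)
        (fun hlt => Prog.Ends.mono (Prog.ends_skip ?_) (by omega) fun _ h => h)
        (fun hlt => Prog.Ends.mono (Prog.Ends.ite (T := 2 * timeUnit n B 0)
          (fun hlt' => Prog.ends_block (k := 2) hB _ (by decide) ?_)
          (fun hlt' => Prog.Ends.mono (Prog.ends_skip ?_) (by omega) fun _ h => h))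
          (by omega) fun _ h => h)) (by omega) fun _ h => h
      · simp [h2] at hlt
        refine ⟨hI1, hI2, fun x' y' h hd => ?_⟩
        rcases hcase x' y' h with h | ⟨rfl, rfl⟩
        · exact hI3 x' y' h hd
        · exact absurd hd (not_le.2 hlt)
      · simp [h2] at hlt hlt'
        have h3 : ((List.foldl (fun m (i : Instr) => i.effect (fun i j => dist (e i) (e j)) m)
            (m₂.setReal 4 (dist x y)) [Instr.realAdd 3 4 1]).setNat 9 (pointNum e y + 1)).real 3 =
            dist x y := by simp [h1₂]
        simp only [I, h3]
        refine ⟨dist_nonneg, Or.inr ⟨x, y, rfl, hlt⟩, fun x' y' h hd => ?_⟩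
        rcases hcase x' y' h with h | ⟨rfl, rfl⟩
        · exact (hI3 x' y' h hd).trans hlt'.le
        · exact le_rfl
      · simp at hlt'
        refine ⟨hI1, hI2, fun x' y' h hd => ?_⟩
        rcases hcase x' y' h with h | ⟨rfl, rfl⟩
        · exact hI3 x' y' h hd
        · exact hlt'
    · rintro m₂ ⟨⟨hI1, hI2, hI3⟩, -⟩
      refine ⟨hI1, hI2, fun x' y' h hd => hI3 x' y' ?_ hd⟩
      rcases Nat.lt_succ_iff_lt_or_eq.1 h with h | h
      · exact Or.inl h
      · exact Or.inr ⟨(pointNum_inj e).1 h, pointNum_lt e y'⟩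
  · rintro m₁ ⟨⟨hI1, hI2, hI3⟩, -⟩
    exact ⟨hI1, hI2, fun x y => hI3 x y (pointNum_lt e x)⟩

/-- A bound for the number of scales that are found if they are to be at most `b`. -/
noncomputable def scaleBound (X : Type*) [MetricSpace X] [Fintype X] (b : ℝ) : ℕ :=
  open Classical in
  if 0 < b then (Finset.univ.filter fun p : X × X => 0 < dist p.1 p.2 ∧ dist p.1 p.2 ≤ b).card + 1
  else 0

lemma scaleBound_le [Fintype X] (b : ℝ) :
    scaleBound X b ≤ Fintype.card X * Fintype.card X + 1 := by
  classical
  rw [scaleBound]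
  split_ifs
  · rw [← Fintype.card_prod]
    exact Nat.succ_le_succ (Finset.card_le_univ _)
  · omega

lemma IsLargestDist.scaleBound_lt [Fintype X] {b s : ℝ} (h : IsLargestDist X b s) (hb : 0 < b) :
    scaleBound X (s / 16) < scaleBound X b := by
  classical
  rw [scaleBound, scaleBound, if_pos hb]
  split_ifs with hs
  · obtain ⟨x, y, hxy, hsb⟩ := h.attained.resolve_left (by linarith)
    refine Nat.succ_lt_succ (Finset.card_lt_card ((Finset.ssubset_iff_of_subset fun p hp => ?_).2
      ⟨(x, y), ?_, ?_⟩))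
    · simp only [Finset.mem_filter, Finset.mem_univ, true_and] at hp ⊢
      exact ⟨hp.1, by linarith⟩
    · simp only [Finset.mem_filter, Finset.mem_univ, true_and]
      exact ⟨by linarith, by linarith⟩
    · simp only [Finset.mem_filter, Finset.mem_univ, true_and, not_and, not_le]
      intro _
      linarith
  · omega

/-- The first `j` scales have been stored; the next one has to be at most `b`. The part of the
memory that comes after them has not been used. -/
structure ScalesStored (e : Fin n ≃ X) (j : ℕ) (m : Memory) (b : ℝ) : Prop where
  ptr : m.nat 5 = rowStart n j
  unused : ∀ a, rowStart n j ≤ a → m.real a = 0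
  entry_eq : ∀ i x, m.entry e i x = 0
  nonneg : ∀ i, 0 ≤ m.scale n i
  step : ∀ i, i + 1 < j → m.scale n (i + 1) ≤ m.scale n i / 16
  gap : ∀ i, i + 1 < j → ∀ x y : X, dist x y ≤ m.scale n i / 16 → dist x y ≤ m.scale n (i + 1)
  dist_le_bound : j = 0 → ∀ x y : X, dist x y ≤ b
  dist_le : 0 < j → ∀ x y : X, dist x y ≤ m.scale n 0
  attained : m.scale n 0 ≤ 0 ∨ ∃ x y : X, m.scale n 0 ≤ dist x y
  bound_eq : ∀ i, j = i + 1 → b = m.scale n i / 16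

/-- Once the bound for the next scale is `0`, all scales are stored, and the later ones are `0`. -/
lemma ScalesStored.isScale {j : ℕ} (h : ScalesStored e j m 0) : IsScale (X := X) (m.scale n) where
  nonneg := h.nonneg
  dist_le x y := by
    rcases Nat.eq_zero_or_pos j with hj | hj
    · exact (h.dist_le_bound hj x y).trans (h.nonneg 0)
    · exact h.dist_le hj x y
  attained := h.attained
  step i := by
    by_cases hi : i + 1 < j
    · exact h.step i hi
    · have h0 : m.scale n (i + 1) = 0 :=
        h.unused _ ((Nat.lt_or_eq_of_le (not_lt.1 hi)).elim
          (fun h => by have := rowStart_lt (n := n) h; omega) fun h => h ▸ le_rfl)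
      rw [h0]
      have := h.nonneg i
      positivity
  gap i x y hd := by
    by_cases hi : i + 1 < j
    · exact h.gap i hi x y hd
    · have h0 : m.scale n i = 0 := by
        rcases (not_lt.1 hi).eq_or_lt with hj | hj
        · linarith [h.bound_eq i hj]
        · refine h.unused _ ((Nat.lt_or_eq_of_le (Nat.lt_succ_iff.1 hj)).elim
            (fun h => by have := rowStart_lt (n := n) h; omega) fun h => h ▸ le_rfl)
      rw [h0, zero_div] at hd
      exact hd.trans (h.nonneg _)

lemma ScalesStored.next {j : ℕ} {b s : ℝ} (h : ScalesStored e j m b) (hs : IsLargestDist X b s)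
    (h5 : m'.nat 5 = rowStart n (j + 1)) (hj : m'.real (rowStart n j) = s)
    (hr : ∀ a, 16 + n ≤ a → a ≠ rowStart n j → m'.real a = m.real a) :
    ScalesStored e (j + 1) m' (s / 16) := by
  have hlt : ∀ i, i < j → m'.scale n i = m.scale n i := fun i hi => by
    have := rowStart_lt (n := n) hi
    exact hr _ (le_rowStart n i) (by omega)
  have hgt : ∀ i, j < i → m'.scale n i = 0 := fun i hi => by
    have h1 := rowStart_lt (n := n) hi
    have h2 := le_rowStart n j
    exact (hr _ (le_rowStart n i) (by omega)).trans (h.unused _ (by omega))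
  have hjs : m'.scale n j = s := hj
  refine ⟨h5, fun a ha => ?_, fun i x => ?_, fun i => ?_, fun i hi => ?_, fun i hi => ?_, by simp,
    fun _ => ?_, ?_, fun i hi => ?_⟩
  · rw [rowStart_succ] at ha
    have := le_rowStart n j
    rw [hr a (by omega) (by omega), h.unused a (by omega)]
  · have h1 := le_rowStart n i
    have h2 := pointNum_lt e x
    rw [← h.entry_eq i x]
    refine hr _ (by omega) ?_
    rcases lt_trichotomy i j with hi | rfl | hi
    · have := rowStart_lt (n := n) hi
      omega
    · omega
    · have := rowStart_lt (n := n) hi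
      omega
  · rcases lt_trichotomy i j with hi | rfl | hi
    · rw [hlt i hi]; exact h.nonneg i
    · rw [hjs]; exact hs.nonneg
    · rw [hgt i hi]
  · rw [hlt i (by omega)]
    rcases Nat.lt_succ_iff_lt_or_eq.1 hi with hi | rfl
    · rw [hlt _ hi]; exact h.step i hi
    · rw [hjs, ← h.bound_eq i rfl]
      rcases hs.attained with h0 | ⟨x, y, -, hsb⟩
      · rw [h0, h.bound_eq i rfl]
        have := h.nonneg i
        positivity
      · exact hsb
  · rw [hlt i (by omega)]
    rcases Nat.lt_succ_iff_lt_or_eq.1 hi with hi | rfl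
    · rw [hlt _ hi]; exact h.gap i hi
    · rw [hjs, ← h.bound_eq i rfl]
      exact hs.dist_le
  · rcases Nat.eq_zero_or_pos j with rfl | hj0
    · rw [hjs]
      exact fun x y => hs.dist_le x y (h.dist_le_bound rfl x y)
    · rw [hlt 0 hj0]; exact h.dist_le hj0
  · rcases Nat.eq_zero_or_pos j with rfl | hj0
    · rw [hjs]
      exact hs.attained.imp le_of_eq fun ⟨x, y, hxy, _⟩ => ⟨x, y, hxy.le⟩
    · rw [hlt 0 hj0]; exact h.attained
  · obtain rfl : j = i := by omega
    rw [hjs]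

lemma scales_ends [Fintype X] (hB : ∀ i j, τ i j ≤ B) (hm : HasConstants n m) (h2 : 0 ≤ m.real 2)
    (hs : ScalesStored e 0 m (m.real 2)) (h0 : m.real 0 = 0) :
    (Prog.while (.realLt 1 2) nextScale).Ends (fun i j => dist (e i) (e j)) τ m
      ((n * n + 1) * (24 * timeUnit n B 2 + 1) + 1) fun m' =>
        HasConstants n m' ∧ m'.real 0 = 0 ∧ ∃ M ≤ n * n + 1, ScalesStored e M m' 0 := by
  have ht0 := one_le_timeUnit n B 0
  have ht1 : timeUnit n B 0 ≤ timeUnit n B 1 := timeUnit_le_succ n B 0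
  have ht2 : timeUnit n B 1 ≤ timeUnit n B 2 := timeUnit_le_succ n B 1
  have hcard : Fintype.card X = n := by rw [← Fintype.card_congr e, Fintype.card_fin]
  have hbound := fun b => scaleBound_le (X := X) b
  rw [hcard] at hbound
  refine Prog.Ends.mono (Prog.Ends.while (m := m) (T := 24 * timeUnit n B 2)
    (fun m' => HasConstants n m' ∧ m'.real 0 = 0 ∧ 0 ≤ m'.real 2 ∧
      ∃ j, j + scaleBound X (m'.real 2) ≤ n * n + 1 ∧ ScalesStored e j m' (m'.real 2))
    (fun m' => scaleBound X (m'.real 2)) ?_ ⟨hm, h0, h2, 0, by simpa using hbound _, hs⟩)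
    (Nat.succ_le_succ (Nat.mul_le_mul_right _ (hbound _))) ?_
  · rintro m₁ ⟨hm₁, h0₁, h2₁, j, hj, hs₁⟩ hb
    rw [Test.Holds, hm₁.realZero] at hb
    refine Prog.Ends.mono (Prog.Ends.seq (largestDist_ends hB hm₁) (T' := 7 * timeUnit n B 0) ?_)
      (by omega) fun _ h => h
    rintro m₂ ⟨hl, hn₂, hr₂⟩
    have hm₂ : HasConstants n m₂ := hm₁.of_eq hn₂ (hr₂ 1 (by decide)) (by decide)
    have h5 : m₂.nat 5 = rowStart n j := (hn₂ 5 (by decide)).trans hs₁.ptr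
    have hj' := le_rowStart n j
    have hlow : ∀ a < 16, a ≠ rowStart n j := fun a ha => by omega
    have hmem : ∀ m', m' = ((m₂.setReal (rowStart n j) (m₂.real 3)).setNat 5
        (rowStart n (j + 1))).setReal 2 (m₂.real 3 / 16) →
        (HasConstants n m' ∧ m'.real 0 = 0 ∧ 0 ≤ m'.real 2 ∧
          ∃ j, j + scaleBound X (m'.real 2) ≤ n * n + 1 ∧ ScalesStored e j m' (m'.real 2)) ∧
        scaleBound X (m'.real 2) < scaleBound X (m₁.real 2) := by
      intro m' hm'
      have h2' : m'.real 2 = m₂.real 3 / 16 := by simp [hm']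
      have hlt := hl.scaleBound_lt hb
      refine ⟨⟨hm₂.of_eq (S := [5]) (fun a ha => ?_) ?_ (by decide), ?_, ?_, j + 1, ?_, ?_⟩, ?_⟩
      · have : a ≠ 5 := by simpa using ha
        simp [hm', this]
      · simp [hm', hlow 1]
      · simp [hm', hlow 0, hr₂ 0, h0₁]
      · rw [h2']
        have := hl.nonneg
        positivity
      · rw [h2']; omega
      · rw [h2']
        refine hs₁.next hl (by simp [hm']) ?_ fun a ha haj => ?_
        · have : rowStart n j ≠ 2 := by omega
          simp [hm', this]
        · have : a ≠ 2 := by omega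
          simp only [hm', Memory.setReal_real, if_neg this, Memory.setNat_real, if_neg haj]
          exact hr₂ a (by simp; omega)
      · rw [h2']; exact hlt
    refine Prog.ends_block (k := 7) hB _ (by decide) (hmem _ ?_)
    have h3 : (3 : ℕ) ≠ rowStart n j := hlow 3 (by omega)
    simp only [List.foldl_cons, List.foldl_nil, effect_realStore, effect_natAdd, effect_realHalf,
      h5, Memory.setReal_real, Memory.setNat_real, Memory.setReal_nat, hm₂.stride, if_neg h3,
      if_true, ← rowStart_succ]
    simp only [Memory.setReal, Memory.setNat, Function.update_idem]
    congr 2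
    ring
  · rintro m₁ ⟨⟨hm₁, h0₁, h2₁, j, hj, hs₁⟩, hb⟩
    rw [Test.Holds, hm₁.realZero, not_lt] at hb
    rw [le_antisymm hb h2₁] at hs₁
    exact ⟨hm₁, h0₁, j, by omega, hs₁⟩

/-! ### The whole program -/

lemma setUp_ends (hB : ∀ i j, τ i j ≤ B)
    (h0 : m.nat 0 = n) (hn : ∀ a ≠ 0, m.nat a = 0) (hr : ∀ a, m.real a = 0) :
    setUp.Ends (fun i j => dist (e i) (e j)) τ m (14 * timeUnit n B 1) fun m' =>
      HasConstants n m' ∧ m'.real 0 = 0 ∧ 0 ≤ m'.real 2 ∧ ScalesStored e 0 m' (m'.real 2) := by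
  have ht0 := one_le_timeUnit n B 0
  have ht1 : timeUnit n B 0 ≤ timeUnit n B 1 := timeUnit_le_succ n B 0
  refine Prog.Ends.mono (Prog.Ends.seq (Prog.ends_block (k := 6)
    (Q := fun m' => HasConstants n m' ∧ m'.nat 5 = rowStart n 0 ∧ m'.nat 9 = 0 ∧
      m'.real = m.real) hB _ (by decide) ?_)
    (T' := 7 * timeUnit n B 1) ?_) (by omega) fun _ h => h
  · refine ⟨⟨?_, ?_, ?_, ?_, ?_, ?_, ?_⟩, ?_, ?_, ?_⟩ <;> simp [h0, hn, hr, rowStart]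
  rintro m₁ ⟨hm₁, h5₁, h9₁, hr₁⟩
  refine Prog.Ends.mono (Prog.Ends.seq (Prog.Ends.forBelow_real (m := m₁) hB (c := 3) (d := 0)
    [] [2, 4] (by decide) (by decide) (by decide) hm₁.size hm₁.one
    (fun k m' => 0 ≤ m'.real 2 ∧ ∀ p x, pointNum e p = 0 → pointNum e x < k →
      dist p x ≤ m'.real 2) (by simp [hr₁, hr]) ?_) (T' := 2 * timeUnit n B 0) ?_)
    (by simp only [zero_add]; omega) fun _ h => h
  · rintro k hk m₂ hn₂ hr₂ h8 ⟨h2, hI⟩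
    obtain ⟨x, rfl⟩ := exists_pointNum e hk
    obtain ⟨p, hp⟩ := exists_pointNum e (Nat.zero_lt_of_lt hk)
    have h9 : m₂.nat 9 = pointNum e p := (hn₂ 9 (by decide)).trans (h9₁.trans hp.symm)
    refine Prog.ends_block (k := 3) hB _ (by decide) ?_
    have hreal : ((List.foldl (fun m (i : Instr) => i.effect (fun i j => dist (e i) (e j)) m) m₂
        [.query 4 9 8, .realAdd 2 2 4]).setNat 8 (pointNum e x + 1)).real 2 =
        m₂.real 2 + dist p x := by simp [h9, h8]
    simp only [hreal]
    refine ⟨add_nonneg h2 dist_nonneg, fun p' y hp' hy => ?_⟩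
    obtain rfl : p' = p := (pointNum_inj e).1 (hp'.trans hp.symm)
    rcases Nat.lt_succ_iff_lt_or_eq.1 hy with hy | hy
    · linarith [hI p' y hp hy, dist_nonneg (x := p') (y := x)]
    · rw [(pointNum_inj e).1 hy]
      linarith
  · rintro m₂ ⟨⟨h2, hI⟩, hn₂, hr₂⟩
    have hzero : ∀ a ∉ [2, 4], m₂.real a = 0 := fun a ha => by rw [hr₂ a ha, hr₁, hr]
    refine Prog.ends_block (k := 2) hB _ (by decide) ?_
    simp only [List.foldl_cons, List.foldl_nil, effect_realAdd]
    set m₃ := m₂.setReal 2 (m₂.real 2 + m₂.real 2) with hm₃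
    have h2₃ : m₃.real 2 = m₂.real 2 + m₂.real 2 := by simp [hm₃]
    have hz₃ : ∀ a ∉ [2, 4], m₃.real a = 0 := fun a ha => by
      have : a ≠ 2 := by rintro rfl; simp at ha
      simp [hm₃, this, hzero a ha]
    have hn₃ : ∀ a ∉ [8], m₃.nat a = m₁.nat a := hn₂
    have hbig : ∀ a, 16 + n ≤ a → m₃.real a = 0 := fun a ha => hz₃ a (by simp; omega)
    have hscale : ∀ i, m₃.scale n i = 0 := fun i => hbig _ (le_rowStart n i)
    refine ⟨hm₁.of_eq hn₃ ?_ (by decide), hz₃ 0 (by decide), by rw [h2₃]; linarith,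
      (hn₃ 5 (by decide)).trans h5₁, fun a ha => hbig a ((le_rowStart n 0).trans ha),
      fun i x => hbig _ ?_, fun i => (hscale i).ge, by simp, by simp, fun _ x y => ?_, by simp,
      Or.inl (hscale 0).le, by simp⟩
    · rw [hz₃ 1 (by decide), hm₁.realZero]
    · have := le_rowStart n i
      omega
    · obtain ⟨p, hp⟩ := exists_pointNum e (Nat.zero_lt_of_lt (pointNum_lt e x))
      have := dist_triangle_left x y p
      linarith [hI p x hp (pointNum_lt e x), hI p y hp (pointNum_lt e y)]

lemma readResult_ends (hB : ∀ i j, τ i j ≤ B) (hm : HasConstants n m) (h0 : m.real 0 = 0) :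
    readResult.Ends (fun i j => dist (e i) (e j)) τ m (16 * timeUnit n B 1) fun m' =>
      0 ≤ m'.real 0 ∧ (∀ x, m.entry e 0 x + m.entry e 1 x ≤ m'.real 0) ∧
        (m'.real 0 = 0 ∨ ∃ x, m'.real 0 = m.entry e 0 x + m.entry e 1 x) := by
  have ht0 := one_le_timeUnit n B 0
  refine Prog.Ends.mono (Prog.Ends.forBelow_real (m := m) hB (c := 12) (d := 0)
    [10] [0, 4, 9] (by decide) (by decide) (by decide) hm.size hm.one
    (fun k m' => 0 ≤ m'.real 0 ∧
      (∀ x, pointNum e x < k → m.entry e 0 x + m.entry e 1 x ≤ m'.real 0) ∧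
      (m'.real 0 = 0 ∨ ∃ x, m'.real 0 = m.entry e 0 x + m.entry e 1 x)) (by simp [h0]) ?_)
    (by simp only [zero_add]; omega) ?_
  · rintro k hk m₁ hn₁ hr₁ h7 ⟨hI1, hI2, hI3⟩
    obtain ⟨y, rfl⟩ := exists_pointNum e hk
    have hm₁ : HasConstants n m₁ := hm.of_eq hn₁ (hr₁ 1 (by decide)) (by decide)
    have he : ∀ i, m₁.real (rowStart n i + 1 + pointNum e y) = m.entry e i y := fun i => by
      have := le_rowStart n i
      exact hr₁ _ (by simp; omega)
    have he0 : m₁.real (16 + n + 1 + pointNum e y) = m.entry e 0 y := by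
      rw [← he 0, rowStart, zero_mul, add_zero]
    have he1 : m₁.real (16 + n + 1 + pointNum e y + (n + 1)) = m.entry e 1 y := by
      rw [← he 1, rowStart, one_mul]
      congr 1
      ring
    have h9 : 16 + n + 1 + pointNum e y + (n + 1) ≠ 9 := by omega
    refine Prog.Ends.mono (Prog.Ends.seq (Prog.ends_block (k := 7)
      (Q := fun m' => m'.real 9 = m.entry e 0 y + m.entry e 1 y ∧ m'.real 0 = m₁.real 0 ∧
        m'.real 1 = 0)
      hB _ (by decide) ?_) (T' := 4 * timeUnit n B 0) ?_) (by omega) fun _ h => h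
    · refine ⟨?_, by simp, by simp [hm₁.realZero]⟩
      simp [hm₁.rows, hm₁.one, hm₁.stride, h7, he0, he1, h9]
    rintro m₂ ⟨h9, h0₂, h1₂⟩
    refine Prog.Ends.mono (Prog.Ends.ite (T := 2 * timeUnit n B 0)
      (fun hlt => Prog.ends_block (k := 2) hB _ (by decide) ?_)
      (fun hlt => Prog.Ends.mono (Prog.ends_skip ?_) (by omega) fun _ h => h))
      (by omega) fun _ h => h
    · rw [Test.Holds, h9, h0₂] at hlt
      have hreal : ((List.foldl (fun m (i : Instr) => i.effect (fun i j => dist (e i) (e j)) m) m₂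
        [.realAdd 0 9 1]).setNat 7 (pointNum e y + 1)).real 0 =
          m.entry e 0 y + m.entry e 1 y := by simp [h9, h1₂]
      simp only [hreal]
      refine ⟨hI1.trans hlt.le, fun x hx => ?_, Or.inr ⟨y, rfl⟩⟩
      rcases Nat.lt_succ_iff_lt_or_eq.1 hx with hx | hx
      · exact (hI2 x hx).trans hlt.le
      · rw [(pointNum_inj e).1 hx]
    · rw [Test.Holds, h9, h0₂, not_lt] at hlt
      simp only [Memory.setNat_real, h0₂]
      refine ⟨hI1, fun x hx => ?_, hI3⟩
      rcases Nat.lt_succ_iff_lt_or_eq.1 hx with hx | hx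
      · exact hI2 x hx
      · rw [(pointNum_inj e).1 hx]
        exact hlt
  · rintro m' ⟨⟨h1, h2, h3⟩, -⟩
    exact ⟨h1, fun x => h2 x (pointNum_lt e x), h3⟩

lemma gammaTwoProg_ends [Fintype X] (hB : ∀ i j, τ i j ≤ B)
    (h0 : m.nat 0 = n) (hn : ∀ a ≠ 0, m.nat a = 0) (hr : ∀ a, m.real a = 0) :
    gammaTwoProg.Ends (fun i j => dist (e i) (e j)) τ m (3000 * timeUnit n B 6) fun m' =>
      0 ≤ m'.real 0 ∧ ∃ (r : ℕ → ℝ) (F : ℕ → X → ℝ) (M : ℕ), IsScale (X := X) r ∧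
        (∀ j x, IsEntry (r j) (F (j + 2)) x (F j x)) ∧ (∀ j, M ≤ j → ∀ x, F j x ≤ 0) ∧
        (∀ x, F 0 x + F 1 x ≤ m'.real 0) ∧ (m'.real 0 = 0 ∨ ∃ x, m'.real 0 = F 0 x + F 1 x) := by
  have htime : 14 * timeUnit n B 1 + ((n * n + 1) * (24 * timeUnit n B 2 + 1) + 1 +
      (rowStart n (n * n + 1) * (113 * timeUnit n B 3 + 1) + 1 + 16 * timeUnit n B 1 + 1) + 1) + 1
      ≤ 3000 * timeUnit n B 6 := by
    have h : ∀ d, timeUnit n B (d + 3) = (n + 1) ^ 3 * timeUnit n B d := fun d => by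
      rw [timeUnit, timeUnit]; ring
    have h3 := one_le_timeUnit n B 3
    have h12 : timeUnit n B 1 ≤ timeUnit n B 2 := timeUnit_le_succ n B 1
    have h23 : timeUnit n B 2 ≤ timeUnit n B 3 := timeUnit_le_succ n B 2
    have h36 := h 3
    have hn1 : n * n + 1 ≤ (n + 1) ^ 3 := by ring_nf; nlinarith
    have hn2 : rowStart n (n * n + 1) ≤ 17 * (n + 1) ^ 3 := by
      rw [rowStart]; ring_nf; nlinarith
    have hn3 : 1 ≤ (n + 1) ^ 3 := Nat.one_le_pow _ _ (Nat.succ_pos n)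
    generalize timeUnit n B 3 = t at *
    generalize (n + 1) ^ 3 = c at *
    have h1 : (n * n + 1) * (24 * timeUnit n B 2 + 1) ≤ c * (25 * t) :=
      Nat.mul_le_mul hn1 (by omega)
    have h2 : rowStart n (n * n + 1) * (113 * t + 1) ≤ 17 * c * (114 * t) :=
      Nat.mul_le_mul hn2 (by omega)
    have h4 : 1 * t ≤ c * t := Nat.mul_le_mul_right _ hn3
    have h5 : c * (25 * t) = 25 * (c * t) := by ring
    have h6 : 17 * c * (114 * t) = 1938 * (c * t) := by ring
    rw [h5] at h1
    rw [h6] at h2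
    rw [h36]
    omega
  refine Prog.Ends.mono (Prog.Ends.seq (setUp_ends (e := e) hB h0 hn hr) ?_) htime
    fun _ h => h
  rintro m₁ ⟨hm₁, h0₁, h2₁, hs₁⟩
  refine Prog.Ends.seq (scales_ends hB hm₁ h2₁ hs₁ h0₁) ?_
  rintro m₂ ⟨hm₂, h0₂, M, hM, hs₂⟩
  have hscale := hs₂.isScale
  have hent : ∀ i, m₂.entry e i = fun _ => 0 := fun i => funext (hs₂.entry_eq i)
  have ht : IsTable e (m₂.scale n) M m₂ := fun i hi x => by
    have h : m₂.scale n i = 0 := by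
      rcases hi.eq_or_lt with rfl | hi
      · exact hs₂.unused _ le_rfl
      · have := rowStart_lt (n := n) hi
        exact hs₂.unused _ (by omega)
    rw [h, hent, hent]
    exact isEntry_zero x
  refine Prog.Ends.mono (Prog.Ends.seq (tableRows_ends hB hscale.nonneg hm₂ hs₂.ptr
    (fun _ => rfl) ht h0₂) (T' := 16 * timeUnit n B 1) ?_) ?_ fun _ h => h
  · rintro m₃ ⟨hm₃, ht₃, h0₃, hM₃⟩
    refine (readResult_ends (e := e) hB hm₃ h0₃).imp fun m' h => ⟨h.1, m₂.scale n, m₃.entry e, M,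
      hscale, fun j x => ht₃ j (Nat.zero_le j) x, fun j hj x => ?_, h.2⟩
    rw [hM₃ j hj, hs₂.entry_eq]
  · have h : rowStart n M ≤ rowStart n (n * n + 1) :=
      Nat.add_le_add_left (Nat.mul_le_mul_right _ hM) _
    have := Nat.mul_le_mul_right (113 * timeUnit n B 3 + 1) h
    omega

end Table

lemma Prog.Ends.outputs {n : ℕ} {D : Fin n → Fin n → ℝ} {τ : Fin n → Fin n → ℕ} {P : Prog}
    {T : ℕ} {Q : Memory → Prop}
    (h : P.Ends D τ ((⟨fun _ => 0, fun _ => 0⟩ : Memory).setNat 0 n) T Q) :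
    ∃ (m : Memory) (t : ℕ), P.Outputs D τ (m.real 0) t ∧ t ≤ T ∧ Q m := by
  obtain ⟨N, m, t, ht, hm, hN⟩ := h
  refine ⟨m, t, ⟨N, ?_⟩, ht, hm⟩
  have h := hN [] 0
  rw [zero_add] at h
  rw [Config.start, h]
  exact ⟨rfl, rfl, rfl⟩

theorem theorem1p4 :
    ∃ (C : ℝ) (P : Prog), 0 < C ∧
      ∀ p : Polynomial ℕ, ∃ q : Polynomial ℕ,
        ∀ (n : ℕ) (X : Type*) [MetricSpace X] (e : Fin n ≃ X) (τ : X → X → ℕ),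
          (∀ x y, τ x y ≤ p.eval n) →
            ∃ (A : ℝ) (t : ℕ),
              P.Outputs (fun i j => dist (e i) (e j)) (fun i j => τ (e i) (e j)) A t ∧
              t ≤ q.eval n ∧
              0 ≤ A ∧
              ENNReal.ofReal A ≤ ENNReal.ofReal C * gammaTwo X ∧
              gammaTwo X ≤ ENNReal.ofReal (C * A) := by
  -- `1032 = 2 * 516`, as the output is a sum of two entries of the table
  refine ⟨1032, gammaTwoProg, by norm_num, fun p =>
    ⟨3000 * ((Polynomial.X + 1) ^ 6 * (p + 5)), fun n X _ e τ hτ => ?_⟩⟩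
  have : Fintype X := Fintype.ofEquiv _ e
  obtain ⟨m, t, hout, ht, hA, r, F, M, hr, hF, hM, hle, hatt⟩ :=
    (gammaTwoProg_ends (e := e) (τ := fun i j => τ (e i) (e j)) (B := p.eval n)
      (m := (⟨fun _ => 0, fun _ => 0⟩ : Memory).setNat 0 n) (fun i j => hτ _ _) (by simp)
      (fun a ha => by simp [ha]) (fun a => rfl)).outputs
  refine ⟨m.real 0, t, hout, ht.trans (le_of_eq ?_), hA, ?_, ?_⟩
  · simp [timeUnit, Polynomial.eval_add, Polynomial.eval_mul, Polynomial.eval_pow]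
  · rcases hatt with h | ⟨x, h⟩
    · simp [h]
    · rw [h, ENNReal.ofReal_add (hF 0 x).nonneg (hF 1 x).nonneg]
      refine (add_le_add (ofReal_value_le_gammaTwo hr hF hM 0 x)
        (ofReal_value_le_gammaTwo hr hF hM 1 x)).trans (le_of_eq ?_)
      rw [← add_mul, ← ENNReal.ofReal_add (by norm_num) (by norm_num)]
      norm_num
  · refine (gammaTwo_le_ofReal_value hr hF (V := m.real 0)
      (fun x => by linarith [hle x, (hF 1 x).nonneg])
      (fun x => by linarith [hle x, (hF 0 x).nonneg])).trans (ENNReal.ofReal_le_ofReal ?_)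
    linarith
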